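/- Let $G=(V,E)$ be a planar graph: a finite multigraph (loops and multiple edges allowed, not necessarily connected) embedded in the plane, with distinct points as vertices and simple polygonal arcs as edges (simple closed polygons for loops), an edge containing no vertex besides its ends and distinct edges meeting only in vertices. Let $G^*=(V^*,E^*)$ be its dual: $V^*$ is the set of faces of $G$ (the connected components of the complement of the drawing, including the outer one), and each edge $e\in E$ has a dual edge $e^*\in E^*$ joining the faces $f,h$ (possibly $f=h$) on whose boundaries $e$ lies. Write $e=\langle ij\rangle$ and $e^*=\langle i^*j^*\rangle$. Let $K_2,K_2',K_4$ be real numbers with $K_2'\ge |K_4|$, and let $$\omega_0=e^{K_2+K_2'+K_4},\quad \omega_1=e^{K_2-K_2'-K_4},\quad \omega_2=e^{-K_2+K_2'-K_4},\quad \omega_3=e^{-K_2-K_2'+K_4}$$ be the edge weights of the Ashkin–Teller model. For real numbers $w_0,\dots,w_3$ put $w(1,1)=w_0$, $w(1,-1)=w_1$, $w(-1,1)=w_2$, $w(-1,-1)=w_3$, and define the partition functions of the Ashkin–Teller model on $G$ and of the mixed Ashkin–Teller model on $G$ and $G^*$ by $$Z_{\rm AT}(G;w_0,\dots,w_3)=\sum_{\sigma\in\{\pm1\}^{V}}\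 \sum_{\tau\in\{\pm1\}^{V}}\ \prod_{e=\langle ij\rangle\in E} w(\sigma_i\sigma_j,\tau_i\tau_j),$$ $$Z_{\rm mAT}(G,G^*;w_0,\dots,w_3)=\sum_{\sigma\in\{\pm1\}^{V}}\ \sum_{\tau\in\{\pm1\}^{V^*}}\ \prod_{e=\langle ij\rangle\in E} w(\sigma_i\sigma_j,\tau_{i^*}\tau_{j^*}).$$ Let $$\widehat\omega_0=\tfrac12(\omega_0+\omega_1),\quad \widehat\omega_1=\tfrac12(\omega_0-\omega_1),\quad \widehat\omega_2=\tfrac12(\omega_2+\omega_3),\quad \widehat\omega_3=\tfrac12(\omega_2-\omega_3).$$ Then $G^*$ is well defined (there are finitely many faces, and every edge of $G$ has a dual edge), the weights $\widehat\omega_0,\dots,\widehat\omega_3$ are non-negative, and $$Z_{\rm AT}(G;\omega_0,\omega_1,\omega_2,\omega_3)\;=\;2^{|V|-1}\,Z_{\rm mAT}(G,G^*;\widehat\omega_0,\widehat\omega_1,\widehat\omega_2,\widehat\omega_3).$$ -/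

import Mathlib

open scoped Graph

noncomputable section

namespace AshkinTeller

/-! ### Plane drawings of multigraphs

Multigraphs (loops and parallel edges allowed, not necessarily connected) are Mathlib's
`Graph α β`. The Euclidean plane is `ℂ`. -/

/-- The polygonal curve with successive corners `p 0, p 1, …, p n`
(the values of `p` beyond `n` play no role). -/
def polyCurve (n : ℕ) (p : ℕ → ℂ) : Set ℂ :=
  ⋃ i < n, segment ℝ (p i) (p (i + 1))

/-- `p 0, …, p n` are the corners of a simple polygonal curve: two different segments meet at
most in the common corner of two consecutive segments, or, if the curve is closed, in the point
where it closes up. So `polyCurve n p` is homeomorphic to `[0,1]` if `p 0 ≠ p n`, and to a circle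
if `p 0 = p n`. -/
structure IsSimplePoly (n : ℕ) (p : ℕ → ℂ) : Prop where
  pos : 0 < n
  nondeg : ∀ i < n, p i ≠ p (i + 1)
  simple : ∀ i j, i < j → j < n → ∀ z ∈ segment ℝ (p i) (p (i + 1)),
    z ∈ segment ℝ (p j) (p (j + 1)) →
      (j = i + 1 ∧ z = p j) ∨ (i = 0 ∧ j + 1 = n ∧ z = p 0 ∧ z = p n)

/-- An embedding of the multigraph `G` in the plane: vertices are distinct points, every edge is a
simple polygonal curve joining its ends (a closed one for a loop), an edge contains no vertices
except its ends, and different edges meet in vertices only. -/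
structure PlaneEmbedding {α β : Type*} (G : Graph α β) where
  /-- the point that represents a vertex -/
  pt : α → ℂ
  /-- the number of straight segments of an edge -/
  len : β → ℕ
  /-- the corners of an edge -/
  corner : β → ℕ → ℂ
  pt_injOn : Set.InjOn pt V(G)
  simple : ∀ e ∈ E(G), IsSimplePoly (len e) (corner e)
  ends : ∀ e x y, G.IsLink e x y →
    s(corner e 0, corner e (len e)) = s(pt x, pt y)
  inc_of_mem : ∀ e ∈ E(G), ∀ x ∈ V(G), pt x ∈ polyCurve (len e) (corner e) → G.Inc e x
  inter_subset : ∀ e ∈ E(G), ∀ f ∈ E(G), e ≠ f →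
    polyCurve (len e) (corner e) ∩ polyCurve (len f) (corner f) ⊆ pt '' V(G)

namespace PlaneEmbedding

variable {α β : Type*} {G : Graph α β}

/-- The curve that represents an edge, including its ends. -/
def curve (P : PlaneEmbedding G) (e : β) : Set ℂ := polyCurve (P.len e) (P.corner e)

/-- The set of points of the plane covered by the drawing. -/
def support (P : PlaneEmbedding G) : Set ℂ := P.pt '' V(G) ∪ ⋃ e ∈ E(G), P.curve e

/-- The faces: the connected components of the complement of the drawing
(the unbounded one included). -/
def faces (P : PlaneEmbedding G) : Set (Set ℂ) :=
  {F | ∃ z ∈ P.supportᶜ, F = connectedComponentIn P.supportᶜ z}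

/-- The dual multigraph of the embedded multigraph `G`. Its vertices are the faces of `G`.
Each edge of `G` is at the same time the label of its dual edge, which joins
`F` and `F'` (possibly `F = F'`) when these are exactly the faces on whose boundary the edge
lies. -/
def dual (P : PlaneEmbedding G) : Graph (Set ℂ) β where
  vertexSet := P.faces
  IsLink e F F' := e ∈ E(G) ∧ F ∈ P.faces ∧ F' ∈ P.faces ∧
    ∀ H ∈ P.faces, P.curve e ⊆ frontier H ↔ H = F ∨ H = F'
  isLink_symm e _ := ⟨fun F F' h => ⟨h.1, h.2.2.1, h.2.1, fun H hH => by
    rw [h.2.2.2 H hH, or_comm]⟩⟩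
  eq_or_eq_of_isLink_of_isLink e F F' K K' h h' :=
    (h'.2.2.2 F h.2.1).1 ((h.2.2.2 F h.2.1).2 (Or.inl rfl))
  left_mem_of_isLink e F F' h := h.2.1

end PlaneEmbedding

/-! ### Ising spins and edge weights

Ising spins take values in `ℤˣ = {1, -1}`. -/

variable {α α' β : Type*}

open Classical in
/-- The product `σ_i σ_j` of the spins at the two ends `i`, `j` of the edge `e`. -/
def bond (G : Graph α β) (σ : V(G) → ℤˣ) (e : β) : ℤˣ :=
  if h : ∃ x y : V(G), G.IsLink e x y then σ h.choose * σ h.choose_spec.choose else 1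

theorem bond_eq (G : Graph α β) (σ : V(G) → ℤˣ) {e : β} {x y : V(G)}
    (h : G.IsLink e x y) : bond G σ e = σ x * σ y := by
  have h' : ∃ x y : V(G), G.IsLink e x y := ⟨x, y, h⟩
  have hl : G.IsLink e h'.choose h'.choose_spec.choose := h'.choose_spec.choose_spec
  rw [bond, dif_pos h']
  generalize h'.choose_spec.choose = b at hl
  generalize h'.choose = a at hl
  rcases hl.eq_and_eq_or_eq_and_eq h with ⟨h1, h2⟩ | ⟨h1, h2⟩
  · rw [Subtype.ext h1, Subtype.ext h2]
  · rw [Subtype.ext h1, Subtype.ext h2, mul_comm]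

/-- The weight of an edge with `σ_i σ_j = s` and `τ_i τ_j = t`: the values for
`(s,t) = (+1,+1), (+1,-1), (-1,+1), (-1,-1)` are `w 0, w 1, w 2, w 3`. -/
def edgeWeight (w : Fin 4 → ℝ) (s t : ℤˣ) : ℝ :=
  if s = 1 then (if t = 1 then w 0 else w 1) else (if t = 1 then w 2 else w 3)

/-- The four Boltzmann weights of the Ashkin–Teller model with couplings `K₂, K₂', K₄`. -/
def boltzmann (K₂ K₂' K₄ : ℝ) : Fin 4 → ℝ :=
  ![Real.exp (K₂ + K₂' + K₄), Real.exp (K₂ - K₂' - K₄),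
    Real.exp (-K₂ + K₂' - K₄), Real.exp (-K₂ - K₂' + K₄)]

/-- The transformed weights `ŵ₀, ŵ₁, ŵ₂, ŵ₃`. -/
def hatWeights (w : Fin 4 → ℝ) : Fin 4 → ℝ :=
  ![(w 0 + w 1) / 2, (w 0 - w 1) / 2, (w 2 + w 3) / 2, (w 2 - w 3) / 2]

/-! ### The Ashkin–Teller model on `G` -/

/-- The Hamiltonian of the Ashkin–Teller model. -/
def hamiltonianAT (G : Graph α β) (K₂ K₂' K₄ : ℝ) (σ τ : V(G) → ℤˣ) : ℝ :=
  -∑ᶠ e ∈ E(G), (K₂ * (bond G σ e : ℝ) + K₂' * (bond G τ e : ℝ)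
    + K₄ * (bond G σ e : ℝ) * (bond G τ e : ℝ))

/-- The partition function of the Ashkin–Teller model in terms of its couplings. -/
def couplingZAT (G : Graph α β) (K₂ K₂' K₄ : ℝ) : ℝ :=
  ∑ᶠ σ : V(G) → ℤˣ, ∑ᶠ τ : V(G) → ℤˣ, Real.exp (-hamiltonianAT G K₂ K₂' K₄ σ τ)

/-- The partition function of the Ashkin–Teller model in terms of its edge weights. -/
def ZAT (G : Graph α β) (w : Fin 4 → ℝ) : ℝ :=
  ∑ᶠ σ : V(G) → ℤˣ, ∑ᶠ τ : V(G) → ℤˣ,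
    ∏ᶠ e ∈ E(G), edgeWeight w (bond G σ e) (bond G τ e)

/-! ### The mixed Ashkin–Teller model on a dual pair

`G` and `G'` are multigraphs with the same set of edge labels, a dual edge having the same label
as the edge it crosses. -/

/-- The Hamiltonian of the mixed Ashkin–Teller model. -/
def hamiltonianMAT (G : Graph α β) (G' : Graph α' β) (K₂ K₂' K₄ : ℝ)
    (σ : V(G) → ℤˣ) (τ : V(G') → ℤˣ) : ℝ :=
  -K₂ * ∑ᶠ e ∈ E(G), (bond G σ e : ℝ) - K₂' * ∑ᶠ e ∈ E(G'), (bond G' τ e : ℝ)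
    - K₄ * ∑ᶠ e ∈ E(G), (bond G σ e : ℝ) * (bond G' τ e : ℝ)

/-- The partition function of the mixed Ashkin–Teller model in terms of its couplings. -/
def couplingZMAT (G : Graph α β) (G' : Graph α' β) (K₂ K₂' K₄ : ℝ) : ℝ :=
  ∑ᶠ σ : V(G) → ℤˣ, ∑ᶠ τ : V(G') → ℤˣ, Real.exp (-hamiltonianMAT G G' K₂ K₂' K₄ σ τ)

/-- The partition function of the mixed Ashkin–Teller model in terms of its edge weights. -/
def ZMAT (G : Graph α β) (G' : Graph α' β) (w : Fin 4 → ℝ) : ℝ :=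
  ∑ᶠ σ : V(G) → ℤˣ, ∑ᶠ τ : V(G') → ℤˣ,
    ∏ᶠ e ∈ E(G), edgeWeight w (bond G σ e) (bond G' τ e)

theorem edgeWeight_boltzmann (K₂ K₂' K₄ : ℝ) (s t : ℤˣ) :
    edgeWeight (boltzmann K₂ K₂' K₄) s t
      = Real.exp (K₂ * (s : ℝ) + K₂' * (t : ℝ) + K₄ * (s : ℝ) * (t : ℝ)) := by
  rcases Int.units_eq_one_or s with rfl | rfl <;> rcases Int.units_eq_one_or t with rfl | rfl <;>
    simp [edgeWeight, boltzmann] <;> ring_nf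

theorem couplingZAT_eq (G : Graph α β) (hE : E(G).Finite) (K₂ K₂' K₄ : ℝ) :
    couplingZAT G K₂ K₂' K₄ = ZAT G (boltzmann K₂ K₂' K₄) := by
  unfold couplingZAT ZAT hamiltonianAT
  refine finsum_congr fun σ => finsum_congr fun τ => ?_
  rw [neg_neg, finsum_mem_eq_finite_toFinset_sum _ hE, finprod_mem_eq_finite_toFinset_prod _ hE,
    Real.exp_sum]
  exact Finset.prod_congr rfl fun e _ => (edgeWeight_boltzmann _ _ _ _ _).symm

theorem couplingZMAT_eq (G : Graph α β) (G' : Graph α' β) (hE : E(G).Finite)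
    (hE' : E(G') = E(G)) (K₂ K₂' K₄ : ℝ) :
    couplingZMAT G G' K₂ K₂' K₄ = ZMAT G G' (boltzmann K₂ K₂' K₄) := by
  unfold couplingZMAT ZMAT hamiltonianMAT
  refine finsum_congr fun σ => finsum_congr fun τ => ?_
  rw [hE']
  simp only [finsum_mem_eq_finite_toFinset_sum _ hE, finprod_mem_eq_finite_toFinset_prod _ hE,
    edgeWeight_boltzmann, ← Real.exp_sum, Finset.sum_add_distrib, Finset.mul_sum, mul_assoc]
  congr 1
  simp only [neg_mul, Finset.sum_neg_distrib]
  ring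

end AshkinTeller

end

noncomputable section

open Topology Set

namespace AshkinTeller

/-! ### Two radii cut a disc into two sectors -/

/-! Fix `σ`. On an edge, the original weight is an affine function of `t = τ_i τ_j`, with
coefficients the transformed weights at `t = 1` and `t = -1`. Expand the product over edges into a
sum over edge sets `T`. The sum over `τ` on the vertices kills every `T` with a vertex of odd degree
and gives `2 ^ |V|` for each even `T`. On the dual side, group the configurations on the faces by
the set `T` of edges across which the spin changes. Each `T` that arises is a cut of the dual and,
since the dual is connected, comes from exactly two configurations, `τ` and `-τ`. The two sums
therefore agree up to the factor `2 ^ |V| / 2` once even edge sets are known to be exactly the cuts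
of the dual (`two_mul_sum_prod_eq`).

That is the planar input, and it is obtained from square roots instead of the Jordan curve theorem.
For an edge with ends `a`, `b`, `polyRoot` is a square root of `(a - z) * (b - z)`, continuous off
the edge and changing sign across it. The product of these over `T` has square `∏ v, (pt v - z) ^
deg v`. If all degrees are even, division by `∏ v, (pt v - z) ^ (deg v / 2)` leaves a function with
values `±1`, constant on faces and flipping exactly across `T`: a colouring (`exists_coloring`).
Conversely, multiplication by a colouring that flips exactly across `T` cancels the jumps, so `∏ v,
(pt v - z) ^ deg v` has a continuous square root off finitely many points; a turn around `v` then
forces `deg v` to be even (`even_degIn_of_coloring`).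

The dual itself rests on a local fact: near an inner point of an edge the drawing cuts a
neighbourhood into two connected sides. So at most two faces touch there, and they are the same all
along the edge. As the plane minus finitely many points is connected, the number of faces is finite
and the dual is connected. -/

/-- The set `S` cuts the open neighbourhood `U` of `x` into two connected pieces `A` and `B`, both
of which accumulate at every point of `S` in `U`. -/
structure IsLocalSplit (S : Set ℂ) (x : ℂ) (U A B : Set ℂ) : Prop where
  isOpen : IsOpen U
  mem : x ∈ U
  isPreconnected_left : IsPreconnected A
  isPreconnected_right : IsPreconnected B
  diff_eq : U \ S = A ∪ B
  subset_closure_left : U ∩ S ⊆ closure A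
  subset_closure_right : U ∩ S ⊆ closure B

theorem IsLocalSplit.image {S : Set ℂ} {x : ℂ} {U A B : Set ℂ} (φ : ℂ ≃ₜ ℂ)
    (h : IsLocalSplit (φ ⁻¹' S) x U A B) :
    IsLocalSplit S (φ x) (φ '' U) (φ '' A) (φ '' B) where
  isOpen := φ.isOpenMap _ h.isOpen
  mem := mem_image_of_mem _ h.mem
  isPreconnected_left := h.isPreconnected_left.image _ φ.continuous.continuousOn
  isPreconnected_right := h.isPreconnected_right.image _ φ.continuous.continuousOn
  diff_eq := by
    rw [← image_union, ← h.diff_eq, image_sdiff φ.injective, image_preimage_eq _ φ.surjective]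
  subset_closure_left := by
    rw [← φ.image_closure, ← image_inter_preimage]
    exact image_mono h.subset_closure_left
  subset_closure_right := by
    rw [← φ.image_closure, ← image_inter_preimage]
    exact image_mono h.subset_closure_right

/-- The open circular sector with vertex `0`, radius `r` and angles between `a` and `b`. -/
def sector (r a b : ℝ) : Set ℂ := Complex.exp '' (Iio (Real.log r) ×ℂ Ioo a b)

theorem isPreconnected_sector (r a b : ℝ) : IsPreconnected (sector r a b) :=
  ((convex_halfSpace_re_lt _).inter
    ((convex_halfSpace_im_gt a).inter (convex_halfSpace_im_lt b))).isPreconnected.image _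
    Complex.continuous_exp.continuousOn

/-- The closure of the half-strip is explicit, and a continuous map sends closures into closures.
Working with `w` instead of `arg` lets a point of the negative axis be approached from both sides,
at angle `π` or `-π`. -/
theorem exp_mem_closure_sector {r a b : ℝ} (hab : a < b) {w : ℂ} (hr : w.re ≤ Real.log r)
    (ha : a ≤ w.im) (hb : w.im ≤ b) : Complex.exp w ∈ closure (sector r a b) := by
  refine image_closure_subset_closure_image Complex.continuous_exp ⟨w, ?_, rfl⟩
  rw [Complex.closure_reProdIm, closure_Ioo hab.ne, closure_Iio]
  exact ⟨hr, ha, hb⟩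

theorem zero_mem_closure_sector {r a b : ℝ} (hab : a < b) : (0 : ℂ) ∈ closure (sector r a b) := by
  have h : Filter.Tendsto (fun t : ℝ => Complex.exp ⟨t, (a + b) / 2⟩) Filter.atBot (𝓝 0) := by
    rw [tendsto_zero_iff_norm_tendsto_zero]
    simpa [Complex.norm_exp] using Real.tendsto_exp_atBot
  refine mem_closure_of_tendsto h ?_
  filter_upwards [Filter.eventually_lt_atBot (Real.log r)] with t ht
  exact ⟨_, ⟨ht, by simp; linarith, by simp; linarith⟩, rfl⟩

theorem mem_sector_iff {r a b : ℝ} (hr : 0 < r) (ha : -Real.pi ≤ a) (hb : b ≤ Real.pi) {w : ℂ} :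
    w ∈ sector r a b ↔ w ∈ Complex.slitPlane ∧ ‖w‖ < r ∧ a < w.arg ∧ w.arg < b := by
  constructor
  · rintro ⟨u, ⟨h1, h2, h3⟩, rfl⟩
    simp only [mem_preimage, mem_Iio] at h1 h2 h3
    have harg : (Complex.exp u).arg = u.im := by
      rw [Complex.arg_exp, toIocMod_eq_self]
      constructor <;> linarith
    refine ⟨?_, ?_, ?_, ?_⟩
    · rw [Complex.mem_slitPlane_iff_arg, harg]
      exact ⟨by linarith, Complex.exp_ne_zero _⟩
    · rw [Complex.norm_exp]
      exact (Real.lt_log_iff_exp_lt hr).1 h1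
    · rwa [harg]
    · rwa [harg]
  · rintro ⟨h0, h1, h2, h3⟩
    have hw := Complex.slitPlane_ne_zero h0
    refine ⟨Complex.log w, ⟨?_, ?_, ?_⟩, Complex.exp_log hw⟩
    · simpa [Complex.log_re] using Real.log_lt_log (norm_pos_iff.2 hw) h1
    · simpa [Complex.log_im] using h2
    · simpa [Complex.log_im] using h3

/-- In this normal form one radius is the negative real axis, the complement of `slitPlane`, and the
other has angle `β`. Off both radii, `arg` decides the sector. -/
theorem isLocalSplit_ball {S : Set ℂ} {r β : ℝ} (hr : 0 < r) (hβ : β ∈ Ioo (-Real.pi) Real.pi)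
    (hS : ∀ w, ‖w‖ < r → (w ∈ S ↔ w ∉ Complex.slitPlane ∨ w.arg = β)) :
    IsLocalSplit S 0 (Metric.ball 0 r) (sector r (-Real.pi) β) (sector r β Real.pi) := by
  have hcl : ∀ a b, a < b → -Real.pi ≤ a → b ≤ Real.pi → (a = -Real.pi ∨ b = Real.pi) →
      (a ≤ β ∧ β ≤ b) → Metric.ball 0 r ∩ S ⊆ closure (sector r a b) := by
    rintro a b hab ha hb hab' ⟨haβ, hβb⟩ w ⟨hw, hwS⟩
    rw [mem_ball_zero_iff] at hw
    rcases eq_or_ne w 0 with rfl | h0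
    · exact zero_mem_closure_sector hab
    have hlog : Real.log ‖w‖ ≤ Real.log r := Real.log_le_log (norm_pos_iff.2 h0) hw.le
    rcases (hS w hw).1 hwS with h | h
    · have harg : w.arg = Real.pi := by
        by_contra hne
        exact h (Complex.mem_slitPlane_iff_arg.2 ⟨hne, h0⟩)
      rcases hab' with rfl | rfl
      -- The principal logarithm puts the negative axis at height `π`; the lower sector sees it at
      -- height `-π`, one period below.
      · have : w = Complex.exp (Complex.log w - 2 * Real.pi * Complex.I) := by
          rw [Complex.exp_sub, Complex.exp_two_pi_mul_I, div_one, Complex.exp_log h0]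
        rw [this]
        apply exp_mem_closure_sector hab
        · simpa [Complex.log_re] using hlog
        · simp [Complex.log_im, harg]; linarith
        · simp [Complex.log_im, harg]; linarith
      · rw [← Complex.exp_log h0]
        apply exp_mem_closure_sector hab
        · simpa [Complex.log_re] using hlog
        · simpa [Complex.log_im, harg] using hab.le
        · simp [Complex.log_im, harg]
    · rw [← Complex.exp_log h0]
      apply exp_mem_closure_sector hab
      · simpa [Complex.log_re] using hlog
      · simpa [Complex.log_im, h] using haβ
      · simpa [Complex.log_im, h] using hβb
  refine ⟨Metric.isOpen_ball, Metric.mem_ball_self hr, isPreconnected_sector _ _ _,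
    isPreconnected_sector _ _ _, ?_, hcl _ _ hβ.1 le_rfl hβ.2.le (Or.inl rfl) ⟨hβ.1.le, le_rfl⟩,
    hcl _ _ hβ.2 hβ.1.le le_rfl (Or.inr rfl) ⟨le_rfl, hβ.2.le⟩⟩
  ext w
  rw [mem_union, mem_sector_iff hr le_rfl hβ.2.le, mem_sector_iff hr hβ.1.le le_rfl, mem_sdiff,
    mem_ball_zero_iff]
  constructor
  · rintro ⟨h1, h2⟩
    rw [hS w h1, not_or, not_not] at h2
    have h3 := Complex.neg_pi_lt_arg w
    have h4 := lt_of_le_of_ne (Complex.arg_le_pi w) (Complex.mem_slitPlane_iff_arg.1 h2.1).1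
    rcases lt_or_gt_of_ne h2.2 with h | h
    · exact Or.inl ⟨h2.1, h1, h3, h⟩
    · exact Or.inr ⟨h2.1, h1, h, h4⟩
  · rintro (⟨h1, h2, h3, h4⟩ | ⟨h1, h2, h3, h4⟩) <;> refine ⟨h2, ?_⟩ <;>
      rw [hS w h2, not_or, not_not]
    · exact ⟨h1, h4.ne⟩
    · exact ⟨h1, h3.ne'⟩

/-- Inside the disc of radius `‖u‖` the segment cannot be told from the whole ray through `u`. -/
theorem mem_segment_zero_iff {u w : ℂ} (hu : u ≠ 0) (hw : ‖w‖ ≤ ‖u‖) :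
    w ∈ segment ℝ u 0 ↔ ∃ t : ℝ, 0 ≤ t ∧ w = t * u := by
  rw [segment_symm, segment_eq_image]
  constructor
  · rintro ⟨t, ht, rfl⟩
    exact ⟨t, ht.1, by simp⟩
  · rintro ⟨t, ht, rfl⟩
    refine ⟨t, ⟨ht, ?_⟩, by simp⟩
    rw [norm_mul, Complex.norm_real, Real.norm_of_nonneg ht] at hw
    exact le_of_mul_le_mul_right (by simpa using hw) (norm_pos_iff.2 hu)

theorem exists_eq_ofReal_mul_iff_arg {v w : ℂ} (hv : v ≠ 0) (hw : w ≠ 0) :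
    (∃ t : ℝ, 0 ≤ t ∧ w = t * v) ↔ w.arg = v.arg := by
  constructor
  · rintro ⟨t, ht, rfl⟩
    have : 0 < t := lt_of_le_of_ne ht (by rintro rfl; simp at hw)
    exact Complex.arg_real_mul _ this
  · intro h
    refine ⟨‖w‖ / ‖v‖, by positivity, ?_⟩
    have := (Complex.arg_eq_arg_iff hv hw).1 h.symm
    push_cast; exact this.symm

/-- Near an inner point of a path made of two segments with different directions, the path cuts
the plane into two pieces. -/
theorem exists_isLocalSplit {S V : Set ℂ} {a x b : ℂ} (hV : V ∈ 𝓝 x)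
    (hS : ∀ z ∈ V, z ∈ S ↔ z ∈ segment ℝ a x ∨ z ∈ segment ℝ x b) (hax : a ≠ x)
    (hb : (b - x) / (x - a) ∈ Complex.slitPlane) :
    ∃ U A B, U ⊆ V ∧ IsLocalSplit S x U A B ∧
      (∀ z ∈ A, ((z - x) / (x - a)).arg < ((b - x) / (x - a)).arg) ∧
      (∀ z ∈ B, ((b - x) / (x - a)).arg < ((z - x) / (x - a)).arg ∧
        ((z - x) / (x - a)).arg < Real.pi) := by
  set d := x - a with hd
  have hd0 : d ≠ 0 := sub_ne_zero.2 hax.symm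
  set v := (b - x) / d with hv
  have hbv : b = x + d * v := by rw [hv]; field_simp; ring
  have hav : a = x + d * (-1) := by rw [hd]; ring
  -- The similarity `w ↦ x + d * w` carries `0`, `-1`, `v` to `x`, `a`, `b`, which reduces to the
  -- normal form with `β = arg v`.
  let φ : ℂ ≃ₜ ℂ := (Homeomorph.mulLeft₀ d hd0).trans (Homeomorph.addLeft x)
  have hφ : ∀ w, φ w = x + d * w := fun w => rfl
  have hφ0 : φ 0 = x := by simp [hφ]
  have hseg : ∀ u w : ℂ, φ w ∈ segment ℝ (x + d * u) x ↔ w ∈ segment ℝ u 0 := by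
    intro u w
    simp only [segment_eq_image, mem_image, hφ]
    refine exists_congr fun t => and_congr_right fun _ => ?_
    simp only [Complex.real_smul, mul_zero, add_zero]
    constructor
    · intro h
      apply mul_left_cancel₀ hd0
      push_cast at h ⊢
      linear_combination h
    · intro h
      push_cast at h ⊢
      linear_combination d * h
  have hv0 : v ≠ 0 := Complex.slitPlane_ne_zero hb
  obtain ⟨ε, hε, hεV⟩ := Metric.mem_nhds_iff.1
    (φ.continuous.continuousAt.preimage_mem_nhds (by rw [hφ0]; exact hV) : φ ⁻¹' V ∈ 𝓝 0)
  -- The bounds `1` and `‖v‖` are the lengths of the normalised segments, so both look like rays in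
  -- the disc.
  have hr : 0 < min ε (min 1 ‖v‖) := lt_min hε (lt_min one_pos (norm_pos_iff.2 hv0))
  set r := min ε (min 1 ‖v‖) with hrdef
  have hβ : v.arg ∈ Ioo (-Real.pi) Real.pi :=
    ⟨Complex.neg_pi_lt_arg _, lt_of_le_of_ne (Complex.arg_le_pi _)
      (Complex.mem_slitPlane_iff_arg.1 hb).1⟩
  have hsp := isLocalSplit_ball (S := φ ⁻¹' S) hr hβ (by
    intro w hw
    have h1 : ‖w‖ < ε := hw.trans_le (min_le_left _ _)
    have h2 : ‖w‖ ≤ ‖(-1 : ℂ)‖ := by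
      simpa using (hw.trans_le ((min_le_right _ _).trans (min_le_left _ _))).le
    have h3 : ‖w‖ ≤ ‖v‖ := (hw.trans_le ((min_le_right _ _).trans (min_le_right _ _))).le
    rw [mem_preimage, hS _ (hεV (mem_ball_zero_iff.2 h1)), segment_symm ℝ x b, hav, hbv, hseg, hseg,
      mem_segment_zero_iff (by simp) h2, mem_segment_zero_iff hv0 h3]
    have h4 : (∃ t : ℝ, 0 ≤ t ∧ w = t * (-1)) ↔ w ∉ Complex.slitPlane := by
      rw [Complex.mem_slitPlane_iff, not_or, not_lt, not_not]
      constructor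
      · rintro ⟨t, ht, rfl⟩
        simpa using ht
      · rintro ⟨h5, h6⟩
        exact ⟨-w.re, by linarith, by apply Complex.ext <;> simp [h6]⟩
    rw [h4]
    rcases eq_or_ne w 0 with rfl | hw0
    · simp
    · rw [exists_eq_ofReal_mul_iff_arg hv0 hw0])
  have hA : ∀ w, (φ w - x) / d = w := by
    intro w; rw [hφ]; field_simp; ring
  refine ⟨φ '' Metric.ball 0 r, _, _, ?_, hφ0 ▸ hsp.image φ, ?_, ?_⟩
  · rintro _ ⟨w, hw, rfl⟩
    exact hεV (Metric.ball_subset_ball (min_le_left _ _) hw)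
  · rintro _ ⟨w, hw, rfl⟩
    rw [mem_sector_iff hr le_rfl hβ.2.le] at hw
    rw [hA]
    exact hw.2.2.2
  · rintro _ ⟨w, hw, rfl⟩
    rw [mem_sector_iff hr hβ.1.le le_rfl] at hw
    rw [hA]
    exact hw.2.2

/-! ### Simple polygonal curves -/

theorem isClosed_segment (a b : ℂ) : IsClosed (segment ℝ a b) := by
  rw [← closure_openSegment]
  exact isClosed_closure

theorem isClosed_polyCurve (n : ℕ) (p : ℕ → ℂ) : IsClosed (polyCurve n p) :=
  (finite_lt_nat n).isClosed_biUnion fun _ _ => isClosed_segment _ _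

theorem mem_polyCurve {n : ℕ} {p : ℕ → ℂ} {z : ℂ} :
    z ∈ polyCurve n p ↔ ∃ i < n, z ∈ segment ℝ (p i) (p (i + 1)) := by
  simp [polyCurve]

theorem segment_eq_union_of_mem {a b x : ℂ} (hx : x ∈ segment ℝ a b) :
    segment ℝ a b = segment ℝ a x ∪ segment ℝ x b := by
  apply Subset.antisymm
  · intro z hz
    by_cases h1 : z = a
    · exact Or.inl (h1 ▸ left_mem_segment ℝ a x)
    by_cases h2 : z = b
    · exact Or.inr (h2 ▸ right_mem_segment ℝ x b)
    have hz' := mem_openSegment_of_ne_left_right (Ne.symm h1) (Ne.symm h2) hz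
    rcases openSegment_subset_union a b (z := x)
      (by
        rw [segment_eq_image_lineMap] at hx
        exact image_subset_range _ _ hx) hz' with h | h | h
    · exact Or.inl (h ▸ right_mem_segment ℝ a x)
    · exact Or.inl (openSegment_subset_segment _ _ _ h)
    · exact Or.inr (openSegment_subset_segment _ _ _ h)
  · exact union_subset ((convex_segment a b).segment_subset (left_mem_segment ℝ a b) hx)
      ((convex_segment a b).segment_subset hx (right_mem_segment ℝ a b))

/-- The direction from `x` to `b` relative to the one from `a` to `x` when `x` is between. -/
theorem exists_sub_eq_mul_of_mem_openSegment {a b x : ℂ} (hx : x ∈ openSegment ℝ a b) :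
    ∃ t : ℝ, 0 < t ∧ b - x = t * (x - a) := by
  obtain ⟨s, t, hs, ht, hst, rfl⟩ := hx
  refine ⟨s / t, by positivity, ?_⟩
  have ht' : (t : ℂ) ≠ 0 := by exact_mod_cast ht.ne'
  have : (s : ℂ) + t = 1 := by exact_mod_cast hst
  have hs' : (s : ℂ) = 1 - t := by linear_combination this
  simp only [Complex.real_smul]
  push_cast
  rw [hs']
  field_simp
  ring

/-- If the quotient were a nonpositive real, `b` would lie on the ray from `x` through `a`, and the
two segments would overlap beyond `x`. -/
theorem div_mem_slitPlane_of_inter_subset {a b x : ℂ} (ha : a ≠ x) (hb : b ≠ x)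
    (h : segment ℝ a x ∩ segment ℝ x b ⊆ {x}) : (b - x) / (x - a) ∈ Complex.slitPlane := by
  by_contra hv
  have hd : x - a ≠ 0 := sub_ne_zero.2 ha.symm
  rw [Complex.mem_slitPlane_iff, not_or, not_lt, not_not] at hv
  set v := (b - x) / (x - a) with hvdef
  have hv' : v = -((-v.re : ℝ) : ℂ) := by apply Complex.ext <;> simp [hv.2]
  set t := -v.re with ht
  have hb' : b = x + t * (a - x) := by
    have : b - x = v * (x - a) := by rw [hvdef]; field_simp
    rw [hv'] at this
    linear_combination this
  have ht0 : 0 < t := by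
    refine lt_of_le_of_ne (by linarith [hv.1]) ?_
    rintro h0
    rw [← h0] at hb'
    exact hb (by simpa using hb')
  have key : ∀ s : ℝ, 0 ≤ s → s ≤ 1 → s ≤ t → s ≠ 0 → False := by
    intro s hs0 hs1 hst hsne
    have h1 : x + s * (a - x) ∈ segment ℝ a x := by
      rw [segment_symm, segment_eq_image]
      refine ⟨s, ⟨hs0, hs1⟩, ?_⟩
      simp only [Complex.real_smul]; push_cast; ring
    have h2 : x + s * (a - x) ∈ segment ℝ x b := by
      rw [segment_eq_image]
      refine ⟨s / t, ⟨by positivity, (div_le_one ht0).2 hst⟩, ?_⟩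
      have : (t : ℂ) ≠ 0 := by exact_mod_cast ht0.ne'
      simp only [Complex.real_smul, hb']; push_cast; field_simp; ring
    have h3 := h ⟨h1, h2⟩
    rw [mem_singleton_iff, add_eq_left, mul_eq_zero] at h3
    rcases h3 with h3 | h3
    · exact hsne (by exact_mod_cast h3)
    · exact ha (sub_eq_zero.1 h3)
  exact key (min 1 t) (le_min zero_le_one ht0.le) (min_le_left _ _) (min_le_right _ _)
    (lt_min one_pos ht0).ne'

namespace IsSimplePoly

variable {n : ℕ} {p : ℕ → ℂ}

theorem eq_of_mem_openSegment (h : IsSimplePoly n p) {i j : ℕ} (hi : i < n) (hj : j < n) {x : ℂ}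
    (hx : x ∈ openSegment ℝ (p i) (p (i + 1))) (hxj : x ∈ segment ℝ (p j) (p (j + 1))) :
    j = i := by
  have hxi := openSegment_subset_segment ℝ _ _ hx
  have h0 : x ≠ p i := by
    rintro rfl; exact h.nondeg i hi (left_mem_openSegment_iff.1 hx)
  have h1 : x ≠ p (i + 1) := by
    rintro rfl; exact h.nondeg i hi (right_mem_openSegment_iff.1 hx)
  rcases lt_trichotomy i j with hij | hij | hij
  · rcases h.simple i j hij hj x hxi hxj with ⟨rfl, hz⟩ | ⟨rfl, -, hz, -⟩
    · exact absurd hz h1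
    · exact absurd hz h0
  · exact hij.symm
  · rcases h.simple j i hij hi x hxj hxi with ⟨-, hz⟩ | ⟨-, hn, -, hz⟩
    · exact absurd hz h0
    · exact absurd (hn ▸ hz) h1

theorem eq_or_eq_of_corner_mem (h : IsSimplePoly n p) {j k : ℕ} (hj : j + 1 < n) (hk : k < n)
    (hx : p (j + 1) ∈ segment ℝ (p k) (p (k + 1))) : k = j ∨ k = j + 1 := by
  rcases lt_trichotomy k j with hkj | hkj | hkj
  · rcases h.simple k j hkj (by omega) _ hx (right_mem_segment ℝ _ _) with ⟨-, hz⟩ | ⟨-, hn, -⟩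
    · exact absurd hz.symm (h.nondeg j (by omega))
    · omega
  · exact Or.inl hkj
  · rcases eq_or_lt_of_le (Nat.succ_le_of_lt hkj) with hkj | hkj
    · exact Or.inr hkj.symm
    · rcases h.simple (j + 1) k hkj hk _ (left_mem_segment ℝ _ _) hx with ⟨rfl, hz⟩ | ⟨h0, -⟩
      · exact absurd hz (h.nondeg (j + 1) hj)
      · omega

theorem ne_ends_of_mem_openSegment (h : IsSimplePoly n p) {i : ℕ} (hi : i < n) {x : ℂ}
    (hx : x ∈ openSegment ℝ (p i) (p (i + 1))) : x ≠ p 0 ∧ x ≠ p n := by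
  have hn := h.pos
  constructor
  · rintro rfl
    obtain rfl := h.eq_of_mem_openSegment hi hn hx (left_mem_segment ℝ _ _)
    exact h.nondeg _ hi (left_mem_openSegment_iff.1 hx)
  · rintro rfl
    obtain ⟨m, rfl⟩ : ∃ m, n = m + 1 := ⟨n - 1, by omega⟩
    obtain rfl := h.eq_of_mem_openSegment hi (Nat.lt_succ_self m) hx (right_mem_segment ℝ _ _)
    exact h.nondeg _ hi (right_mem_openSegment_iff.1 hx)

theorem corner_ne_ends (h : IsSimplePoly n p) {j : ℕ} (hj : j + 1 < n) :
    p (j + 1) ≠ p 0 ∧ p (j + 1) ≠ p n := by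
  constructor
  · intro h0
    rcases h.eq_or_eq_of_corner_mem hj h.pos (h0 ▸ left_mem_segment ℝ _ _) with rfl | h1
    · exact h.nondeg _ (by omega) h0.symm
    · omega
  · intro h0
    obtain ⟨m, rfl⟩ : ∃ m, n = m + 1 := ⟨n - 1, by omega⟩
    rcases h.eq_or_eq_of_corner_mem hj (Nat.lt_succ_self m) (h0 ▸ right_mem_segment ℝ _ _)
      with rfl | rfl
    · omega
    · exact h.nondeg _ hj h0

theorem mem_openSegment_or_corner {x : ℂ} (hx : x ∈ polyCurve n p)
    (h0 : x ≠ p 0) (hn : x ≠ p n) :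
    (∃ i < n, x ∈ openSegment ℝ (p i) (p (i + 1))) ∨ ∃ j, j + 1 < n ∧ x = p (j + 1) := by
  obtain ⟨i, hi, hxi⟩ := mem_polyCurve.1 hx
  by_cases h1 : x = p i
  · rcases i with _ | j
    · exact absurd h1 h0
    · exact Or.inr ⟨j, hi, h1⟩
  by_cases h2 : x = p (i + 1)
  · rcases eq_or_lt_of_le (Nat.succ_le_of_lt hi) with h3 | h3
    · exact absurd (h3 ▸ h2) hn
    · exact Or.inr ⟨i, h3, h2⟩
  exact Or.inl ⟨i, hi, mem_openSegment_of_ne_left_right (Ne.symm h1) (Ne.symm h2) hxi⟩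

/-- The segments that miss `x` form a finite union of closed sets; its complement is the
neighbourhood. -/
theorem exists_nhds_mem_polyCurve_iff (n : ℕ) (p : ℕ → ℂ) (x : ℂ) :
    ∃ V ∈ 𝓝 x, ∀ z ∈ V, z ∈ polyCurve n p ↔
      ∃ k < n, x ∈ segment ℝ (p k) (p (k + 1)) ∧ z ∈ segment ℝ (p k) (p (k + 1)) := by
  refine ⟨(⋃ k ∈ {k | k < n ∧ x ∉ segment ℝ (p k) (p (k + 1))}, segment ℝ (p k) (p (k + 1)))ᶜ,
    ?_, ?_⟩
  · refine (IsClosed.isOpen_compl (self := ?_)).mem_nhds ?_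
    · exact ((finite_lt_nat n).subset fun k hk => hk.1).isClosed_biUnion
        fun _ _ => isClosed_segment _ _
    · simp
  · intro z hz
    simp only [mem_ofPred_eq, mem_compl_iff, mem_iUnion, not_exists] at hz
    rw [mem_polyCurve]
    refine exists_congr fun k => and_congr_right fun hk => ⟨fun h => ⟨?_, h⟩, fun h => h.2⟩
    by_contra hx
    exact hz k ⟨hk, hx⟩ h

/-- Near a point in the interior of a segment, the curve is that segment. -/
theorem exists_nhds_of_mem_openSegment (h : IsSimplePoly n p) {i : ℕ} (hi : i < n) {x : ℂ}
    (hx : x ∈ openSegment ℝ (p i) (p (i + 1))) :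
    ∃ V ∈ 𝓝 x, ∀ z ∈ V, z ∈ polyCurve n p ↔
      z ∈ segment ℝ (p i) x ∨ z ∈ segment ℝ x (p (i + 1)) := by
  obtain ⟨V, hV, hVz⟩ := exists_nhds_mem_polyCurve_iff n p x
  have hx' := openSegment_subset_segment ℝ _ _ hx
  refine ⟨V, hV, fun z hz => ?_⟩
  rw [hVz z hz, ← mem_union, ← segment_eq_union_of_mem hx']
  constructor
  · rintro ⟨k, hk, hxk, hzk⟩
    rwa [← h.eq_of_mem_openSegment hi hk hx hxk]
  · exact fun hzi => ⟨i, hi, hx', hzi⟩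

/-- Near an inner corner, the curve consists of the two adjacent segments. -/
theorem exists_nhds_of_corner (h : IsSimplePoly n p) {j : ℕ} (hj : j + 1 < n) :
    ∃ V ∈ 𝓝 (p (j + 1)), ∀ z ∈ V, z ∈ polyCurve n p ↔
      z ∈ segment ℝ (p j) (p (j + 1)) ∨ z ∈ segment ℝ (p (j + 1)) (p (j + 2)) := by
  obtain ⟨V, hV, hVz⟩ := exists_nhds_mem_polyCurve_iff n p (p (j + 1))
  refine ⟨V, hV, fun z hz => ?_⟩
  rw [hVz z hz]
  constructor
  · rintro ⟨k, hk, hxk, hzk⟩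
    rcases h.eq_or_eq_of_corner_mem hj hk hxk with rfl | rfl
    · exact Or.inl hzk
    · exact Or.inr hzk
  · rintro (hz | hz)
    · exact ⟨j, by omega, right_mem_segment ℝ _ _, hz⟩
    · exact ⟨j + 1, hj, left_mem_segment ℝ _ _, hz⟩

theorem corner_div_mem_slitPlane (h : IsSimplePoly n p) {j : ℕ} (hj : j + 1 < n) :
    (p (j + 2) - p (j + 1)) / (p (j + 1) - p j) ∈ Complex.slitPlane := by
  refine div_mem_slitPlane_of_inter_subset (h.nondeg j (by omega)) (h.nondeg (j + 1) hj).symm ?_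
  rintro z ⟨h1, h2⟩
  rcases h.simple j (j + 1) (Nat.lt_succ_self j) hj z h1 h2 with ⟨-, hz⟩ | ⟨rfl, rfl, hz, hz'⟩
  · exact hz
  -- Here the curve would be closed with just two segments. They would coincide as sets, which an
  -- inner point of the first one contradicts.
  · obtain ⟨m, hm⟩ : (openSegment ℝ (p 0) (p 1)).Nonempty :=
      ⟨_, 1 / 2, 1 / 2, by norm_num, by norm_num, by norm_num, rfl⟩
    have hm' := openSegment_subset_segment ℝ _ _ hm
    rw [segment_symm, ← hz, hz'] at hm'
    exact absurd (h.eq_of_mem_openSegment (by omega) hj hm hm') (by omega)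

end IsSimplePoly

/-! ### A square root of `(p 0 - z) (p n - z)` with branch cut along a polygonal curve -/

theorem cpow_half_sq (w : ℂ) : (w ^ (1 / 2 : ℂ)) ^ 2 = w := by
  rw [one_div]
  exact_mod_cast Complex.cpow_nat_inv_pow w (n := 2) two_ne_zero

/-- Together with `cpow_half_of_im_neg` this exhibits the jump of the principal root at the negative
axis as a pure sign: `(-w) ^ (1 / 2)` is continuous there. -/
theorem cpow_half_of_im_pos {w : ℂ} (hw : 0 < w.im) :
    w ^ (1 / 2 : ℂ) = Complex.I * (-w) ^ (1 / 2 : ℂ) := by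
  have h0 : w ≠ 0 := by rintro rfl; simp at hw
  rw [Complex.cpow_def_of_ne_zero h0, Complex.cpow_def_of_ne_zero (neg_ne_zero.2 h0)]
  have h1 : Complex.log w = Complex.log (-w) + Real.pi * Complex.I := by
    rw [Complex.log, Complex.log, norm_neg, Complex.arg_neg_eq_arg_sub_pi_of_im_pos hw]
    push_cast; ring
  have h2 : (Real.pi * Complex.I * (1 / 2) : ℂ) = Real.pi / 2 * Complex.I := by ring
  rw [h1, add_mul, Complex.exp_add, mul_comm, h2, Complex.exp_pi_div_two_mul_I]

theorem cpow_half_of_im_neg {w : ℂ} (hw : w.im < 0) :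
    w ^ (1 / 2 : ℂ) = -(Complex.I * (-w) ^ (1 / 2 : ℂ)) := by
  have h := cpow_half_of_im_pos (w := -w) (by simpa using hw)
  rw [neg_neg] at h
  rw [h, ← mul_assoc, Complex.I_mul_I]
  ring

theorem continuousAt_cpow_half {f : ℂ → ℂ} {z : ℂ} (hf : ContinuousAt f z)
    (hz : f z ∈ Complex.slitPlane) : ContinuousAt (fun z => f z ^ (1 / 2 : ℂ)) z :=
  hf.cpow continuousAt_const hz

/-- A square root of `z ↦ (p 0 - z) * (p n - z)`, continuous off `polyCurve n p`. -/
def polyRoot (n : ℕ) (p : ℕ → ℂ) (z : ℂ) : ℂ :=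
  (p 0 - z) * ∏ i ∈ Finset.range n, ((p (i + 1) - z) / (p i - z)) ^ (1 / 2 : ℂ)

/-- Squaring removes the roots and the quotients telescope. The corners are excluded because the
intermediate factors are cancelled as denominators. -/
theorem polyRoot_sq {n : ℕ} {p : ℕ → ℂ} {z : ℂ} (hz : ∀ i ≤ n, z ≠ p i) :
    polyRoot n p z ^ 2 = (p 0 - z) * (p n - z) := by
  have h : ∏ i ∈ Finset.range n, (p (i + 1) - z) / (p i - z) = (p n - z) / (p 0 - z) := by
    induction n with
    | zero => simp [sub_ne_zero.2 (hz 0 le_rfl).symm]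
    | succ n ih =>
      rw [Finset.prod_range_succ, ih fun i hi => hz i (hi.trans n.le_succ)]
      have := sub_ne_zero.2 (hz n n.le_succ).symm
      field_simp
  rw [polyRoot, mul_pow, ← Finset.prod_pow]
  simp only [cpow_half_sq]
  rw [h]
  have := sub_ne_zero.2 (hz 0 n.zero_le).symm
  field_simp

/-- A quotient `-t` with `t ≥ 0` means that `p` and `q` lie in opposite directions from `z`, which
places `z` on the segment with weights `t / (1 + t)` and `1 / (1 + t)`. -/
theorem div_mem_slitPlane_of_notMem_segment {p q z : ℂ} (h : z ∉ segment ℝ p q) :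
    (q - z) / (p - z) ∈ Complex.slitPlane := by
  by_contra hv
  have hp : p - z ≠ 0 := sub_ne_zero.2 (by rintro rfl; exact h (left_mem_segment ℝ _ _))
  rw [Complex.mem_slitPlane_iff, not_or, not_lt, not_not] at hv
  set v := (q - z) / (p - z) with hvdef
  have hv' : v = -((-v.re : ℝ) : ℂ) := by apply Complex.ext <;> simp [hv.2]
  have ht0 : 0 ≤ -v.re := by linarith [hv.1]
  generalize -v.re = t at hv' ht0
  have hq : q - z = -t * (p - z) := by rw [← hv', hvdef]; field_simp
  have ht : (1 + t : ℂ) ≠ 0 := by exact_mod_cast (by positivity : (1 + t : ℝ) ≠ 0)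
  refine h ⟨t / (1 + t), 1 / (1 + t), by positivity, by positivity, by field_simp; ring, ?_⟩
  simp only [Complex.real_smul]
  push_cast
  field_simp
  linear_combination hq

theorem continuousAt_half_segment {p q z : ℂ} (h : z ∉ segment ℝ p q) :
    ContinuousAt (fun z => ((q - z) / (p - z)) ^ (1 / 2 : ℂ)) z := by
  have hp : p - z ≠ 0 := sub_ne_zero.2 (by rintro rfl; exact h (left_mem_segment ℝ _ _))
  exact continuousAt_cpow_half (by fun_prop (disch := assumption))
    (div_mem_slitPlane_of_notMem_segment h)

theorem continuousAt_polyRoot {n : ℕ} {p : ℕ → ℂ} {z : ℂ} (hz : z ∉ polyCurve n p) :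
    ContinuousAt (polyRoot n p) z := by
  refine ContinuousAt.mul (by fun_prop) (tendsto_finsetProd _ fun i hi => ?_)
  exact continuousAt_half_segment fun h => hz (mem_polyCurve.2 ⟨i, Finset.mem_range.1 hi, h⟩)

/-- The function `polyRoot` changes its sign across the curve. -/
theorem IsSimplePoly.exists_polyRoot_flip {n : ℕ} {p : ℕ → ℂ} (h : IsSimplePoly n p) {i : ℕ}
    (hi : i < n) {x : ℂ} (hx : x ∈ openSegment ℝ (p i) (p (i + 1))) :
    ∃ s : ℂ → ℂ, ContinuousAt s x ∧
      (∀ z, ((z - x) / (x - p i)).im < 0 → polyRoot n p z = -s z) ∧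
      ∀ z, 0 < ((z - x) / (x - p i)).im → polyRoot n p z = s z := by
  obtain ⟨t, ht, hq⟩ := exists_sub_eq_mul_of_mem_openSegment hx
  have hd : x - p i ≠ 0 := by
    refine sub_ne_zero.2 ?_
    rintro rfl
    exact h.nondeg i hi (left_mem_openSegment_iff.1 hx)
  -- In the coordinate `ζ` along the segment the quotient is `(ζ - t) / (1 + ζ)`, with imaginary
  -- part `(1 + t) * im ζ / |1 + ζ|²`: its sign tells the side of the segment.
  have him : ∀ z, ∃ c : ℝ, ((z - x) / (x - p i)).im ≠ 0 → 0 < c ∧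
      ((p (i + 1) - z) / (p i - z)).im = c * ((z - x) / (x - p i)).im := by
    intro z
    set ζ := (z - x) / (x - p i) with hζ
    have hz : z = x + (x - p i) * ζ := by rw [hζ]; field_simp; ring
    refine ⟨(1 + t) / Complex.normSq (1 + ζ), fun h0 => ?_⟩
    have h1 : 1 + ζ ≠ 0 := by
      intro h1
      apply h0
      simpa using congrArg Complex.im h1
    have h2 : (p (i + 1) - z) / (p i - z) = (ζ - t) / (1 + ζ) := by
      have h3 : p i - z = -((x - p i) * (1 + ζ)) := by rw [hz]; ring
      have h4 : p (i + 1) - z = -((x - p i) * (ζ - t)) := by rw [hz]; linear_combination hq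
      rw [h3, h4, neg_div_neg_eq, mul_div_mul_left _ _ hd]
    have h5 := Complex.normSq_pos.2 h1
    refine ⟨by positivity, ?_⟩
    rw [h2, Complex.div_im]
    simp
    field_simp
    ring
  have hrest : ContinuousAt (fun z => ∏ j ∈ (Finset.range n).erase i,
      ((p (j + 1) - z) / (p j - z)) ^ (1 / 2 : ℂ)) x := by
    refine tendsto_finsetProd _ fun j hj => continuousAt_half_segment fun hxj => ?_
    rw [Finset.mem_erase, Finset.mem_range] at hj
    exact hj.1 (h.eq_of_mem_openSegment hi hj.2 hx hxj)
  have hsplit : ∀ z, polyRoot n p z = (p 0 - z) * (((p (i + 1) - z) / (p i - z)) ^ (1 / 2 : ℂ) *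
      ∏ j ∈ (Finset.range n).erase i, ((p (j + 1) - z) / (p j - z)) ^ (1 / 2 : ℂ)) := fun z => by
    rw [polyRoot, ← Finset.mul_prod_erase _ _ (Finset.mem_range.2 hi)]
  -- Only factor `i` jumps at `x`. It is replaced by its continuation from the side of positive
  -- imaginary part, continuous because minus the quotient equals `t > 0` at `x`.
  refine ⟨fun z => (p 0 - z) * ((Complex.I * (-((p (i + 1) - z) / (p i - z))) ^ (1 / 2 : ℂ)) *
      ∏ j ∈ (Finset.range n).erase i, ((p (j + 1) - z) / (p j - z)) ^ (1 / 2 : ℂ)), ?_, ?_, ?_⟩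
  · refine ContinuousAt.mul (by fun_prop) (ContinuousAt.mul (continuousAt_const.mul ?_) hrest)
    have hp : p i - x ≠ 0 := by rw [← neg_sub]; exact neg_ne_zero.2 hd
    refine continuousAt_cpow_half (by fun_prop (disch := assumption)) ?_
    have : -((p (i + 1) - x) / (p i - x)) = t := by
      rw [hq, ← neg_sub x (p i)]; field_simp
    rw [this]
    exact Complex.ofReal_mem_slitPlane.2 ht
  · intro z hz
    obtain ⟨c, hc⟩ := him z
    obtain ⟨hc, hc'⟩ := hc hz.ne
    have : ((p (i + 1) - z) / (p i - z)).im < 0 := by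
      rw [hc']; exact mul_neg_of_pos_of_neg hc hz
    rw [hsplit, cpow_half_of_im_neg this]
    ring
  · intro z hz
    obtain ⟨c, hc⟩ := him z
    obtain ⟨hc, hc'⟩ := hc hz.ne'
    have : 0 < ((p (i + 1) - z) / (p i - z)).im := by
      rw [hc']; exact mul_pos hc hz
    rw [hsplit, cpow_half_of_im_pos this]

/-- On a punctured disc, a power of the distance to the centre has a continuous square root only
if the exponent is even. -/
theorem even_of_continuousOn_sq_eq {v : ℂ} {ε : ℝ} (hε : 0 < ε) {H R : ℂ → ℂ} {d : ℕ}
    (hH : ContinuousOn H (Metric.ball v ε \ {v})) (hR : Continuous R) (hRv : R v ≠ 0)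
    (h : ∀ z ∈ Metric.ball v ε \ {v}, H z ^ 2 = (v - z) ^ d * R z) : Even d := by
  have hslit : ∀ᶠ z in 𝓝 v, R z / R v ∈ Complex.slitPlane := by
    refine (hR.div_const (R v)).continuousAt.eventually_mem
      (Complex.isOpen_slitPlane.mem_nhds ?_)
    rw [div_self hRv]
    exact Complex.one_mem_slitPlane
  obtain ⟨δ, hδ, hδR⟩ := Metric.eventually_nhds_iff.1 hslit
  set r := min ε δ / 2 with hr
  have hr0 : 0 < r := by positivity
  have hrε : r < ε := by have := min_le_left ε δ; linarith [lt_min hε hδ]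
  have hrδ : r < δ := by have := min_le_right ε δ; linarith [lt_min hε hδ]
  set γ : ℝ → ℂ := fun θ => v - r * Complex.exp (θ * Complex.I) with hγ
  have hγc : Continuous γ := by fun_prop
  have hdist : ∀ θ, dist (γ θ) v = r := by
    intro θ
    rw [dist_eq_norm]
    simp [hγ, Complex.norm_exp_ofReal_mul_I, abs_of_pos hr0]
  have hmem : ∀ θ, γ θ ∈ Metric.ball v ε \ {v} := fun θ =>
    ⟨by rw [Metric.mem_ball, hdist]; exact hrε, fun h0 => by
      have := hdist θ
      rw [mem_singleton_iff.1 h0, dist_self] at this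
      exact hr0.ne this⟩
  have hslitγ : ∀ θ, R (γ θ) / R v ∈ Complex.slitPlane := fun θ =>
    hδR (by rw [hdist]; exact hrδ)
  -- On the circle, `M` is `H` divided by a continuous root of the angular part `exp (i d θ) * R / R
  -- v` of its square. So `M ^ 2` is constant, hence `M` is constant, whereas a full turn multiplies
  -- it by `(-1) ^ d`.
  set M : ℝ → ℂ := fun θ => H (γ θ) * Complex.exp (-(d * (θ * Complex.I) / 2)) /
    (R (γ θ) / R v) ^ (1 / 2 : ℂ) with hM
  have hMc : Continuous M := by
    refine Continuous.div ((hH.comp_continuous hγc hmem).mul (by fun_prop)) ?_ fun θ => ?_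
    · exact ((hR.comp hγc).div_const _).cpow continuous_const hslitγ
    · intro h0
      have := cpow_half_sq (R (γ θ) / R v)
      rw [h0, zero_pow two_ne_zero] at this
      exact Complex.slitPlane_ne_zero (hslitγ θ) this.symm
  have hMsq : ∀ θ, M θ ^ 2 = r ^ d * R v := by
    intro θ
    have h1 : R (γ θ) ≠ 0 := fun h0 => Complex.slitPlane_ne_zero (hslitγ θ) (by rw [h0, zero_div])
    have h2 : Complex.exp (-(d * (θ * Complex.I) / 2)) ^ 2
        = (Complex.exp (θ * Complex.I) ^ d)⁻¹ := by
      rw [← Complex.exp_nat_mul, ← Complex.exp_nat_mul, ← Complex.exp_neg]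
      congr 1; push_cast; ring
    have h3 : v - γ θ = r * Complex.exp (θ * Complex.I) := by simp [hγ]
    have h4 := Complex.exp_ne_zero (θ * Complex.I)
    rw [hM]
    simp only
    rw [div_pow, mul_pow, cpow_half_sq, h _ (hmem θ), h2, h3, mul_pow]
    field_simp
  have hM0 : M 0 ≠ 0 := by
    intro h0
    have := hMsq 0
    rw [h0, zero_pow two_ne_zero] at this
    have hr' : (r : ℂ) ≠ 0 := by exact_mod_cast hr0.ne'
    exact mul_ne_zero (pow_ne_zero d hr') hRv this.symm
  have hM2 : M (2 * Real.pi) = (-1) ^ d * M 0 := by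
    have h1 : γ (2 * Real.pi) = γ 0 := by
      simp [hγ, Complex.exp_two_pi_mul_I]
    have h2 : Complex.exp (-(d * (((2 * Real.pi : ℝ) : ℂ) * Complex.I) / 2)) = (-1) ^ d := by
      have : -(d * (((2 * Real.pi : ℝ) : ℂ) * Complex.I) / 2) = d * -(Real.pi * Complex.I) := by
        push_cast; ring
      rw [this, Complex.exp_nat_mul, Complex.exp_neg, Complex.exp_pi_mul_I]
      norm_num
    simp only [hM]
    rw [h1, h2]
    simp
    ring
  rcases isPreconnected_univ.eq_or_eq_neg_of_sq_eq (f := M) (g := fun _ => M 0)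
    hMc.continuousOn continuousOn_const (fun θ _ => by
      simp only [Pi.pow_apply]
      rw [hMsq, hMsq]) (fun _ => hM0) with h1 | h1
  · have h2 := h1 (mem_univ (2 * Real.pi))
    rw [hM2] at h2
    by_contra hd
    rw [Nat.not_even_iff_odd] at hd
    rw [hd.neg_one_pow, neg_one_mul, neg_eq_self] at h2
    exact hM0 h2
  · have h2 := h1 (mem_univ 0)
    exact absurd (self_eq_neg.1 h2) hM0

namespace PlaneEmbedding

/-! ### The drawing near an edge -/

variable {α β : Type*} {G : Graph α β} (P : PlaneEmbedding G)

theorem exists_isLink_corner {e : β} (he : e ∈ E(G)) :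
    ∃ x y, G.IsLink e x y ∧ P.corner e 0 = P.pt x ∧ P.corner e (P.len e) = P.pt y := by
  obtain ⟨x, y, h⟩ := (G.edge_mem_iff_exists_isLink e).1 he
  rcases Sym2.eq_iff.1 (P.ends e x y h) with h' | h'
  · exact ⟨x, y, h, h'⟩
  · exact ⟨y, x, h.symm, h'⟩

theorem eq_ends_of_pt_mem {e : β} (he : e ∈ E(G)) {v : α} (hv : v ∈ V(G))
    (h : P.pt v ∈ P.curve e) : P.pt v = P.corner e 0 ∨ P.pt v = P.corner e (P.len e) := by
  obtain ⟨y, hy⟩ := P.inc_of_mem e he v hv h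
  rcases Sym2.eq_iff.1 (P.ends e v y hy) with h' | h'
  · exact Or.inl h'.1.symm
  · exact Or.inr h'.2.symm

theorem notMem_pt_image_of_ne {e : β} (he : e ∈ E(G)) {x : ℂ} (hx : x ∈ P.curve e)
    (h : x ≠ P.corner e 0 ∧ x ≠ P.corner e (P.len e)) : x ∉ P.pt '' V(G) := by
  rintro ⟨v, hv, rfl⟩
  rcases P.eq_ends_of_pt_mem he hv hx with h' | h'
  · exact h.1 h'
  · exact h.2 h'

theorem ends_mem_pt_image {e : β} (he : e ∈ E(G)) :
    P.corner e 0 ∈ P.pt '' V(G) ∧ P.corner e (P.len e) ∈ P.pt '' V(G) := by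
  obtain ⟨x, y, h, hx, hy⟩ := P.exists_isLink_corner he
  exact ⟨⟨x, h.left_mem, hx.symm⟩, ⟨y, h.right_mem, hy.symm⟩⟩

theorem segment_subset_curve {e : β} {i : ℕ} (hi : i < P.len e) :
    segment ℝ (P.corner e i) (P.corner e (i + 1)) ⊆ P.curve e :=
  fun _ hz => mem_polyCurve.2 ⟨i, hi, hz⟩

theorem curve_subset_support {e : β} (he : e ∈ E(G)) : P.curve e ⊆ P.support :=
  fun _ hz => Or.inr (mem_biUnion he hz)

theorem openSegment_subset {e : β} (he : e ∈ E(G)) {i : ℕ} (hi : i < P.len e) :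
    openSegment ℝ (P.corner e i) (P.corner e (i + 1)) ⊆ P.curve e \ P.pt '' V(G) := fun _ hz =>
  have hz' := P.segment_subset_curve hi (openSegment_subset_segment _ _ _ hz)
  ⟨hz', P.notMem_pt_image_of_ne he hz' ((P.simple e he).ne_ends_of_mem_openSegment hi hz)⟩

theorem corner_mem {e : β} (he : e ∈ E(G)) {j : ℕ} (hj : j + 1 < P.len e) :
    P.corner e (j + 1) ∈ P.curve e \ P.pt '' V(G) :=
  have h := P.segment_subset_curve hj (left_mem_segment ℝ _ _)
  ⟨h, P.notMem_pt_image_of_ne he h ((P.simple e he).corner_ne_ends hj)⟩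

variable (hV : V(G).Finite) (hE : E(G).Finite)
include hV hE

theorem isClosed_support : IsClosed P.support :=
  (hV.image _).isClosed.union (hE.isClosed_biUnion fun _ _ => isClosed_polyCurve _ _)

/-- All vertices and all other edges together form a closed set that misses `x`. -/
theorem exists_nhds_mem_support_iff {e : β} (he : e ∈ E(G)) {x : ℂ}
    (hx : x ∈ P.curve e \ P.pt '' V(G)) :
    ∃ V ∈ 𝓝 x, ∀ z ∈ V, z ∈ P.support ↔ z ∈ P.curve e := by
  refine ⟨(P.pt '' V(G) ∪ ⋃ f ∈ E(G) \ {e}, P.curve f)ᶜ, ?_, ?_⟩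
  · refine (IsClosed.isOpen_compl (self := ?_)).mem_nhds ?_
    · exact (hV.image _).isClosed.union
        (hE.sdiff.isClosed_biUnion fun _ _ => isClosed_polyCurve _ _)
    · rintro (h | h)
      · exact hx.2 h
      · simp only [mem_iUnion] at h
        obtain ⟨f, hf, hxf⟩ := h
        exact hx.2 (P.inter_subset e he f hf.1 (fun h => hf.2 h.symm) ⟨hx.1, hxf⟩)
  · intro z hz
    rw [mem_compl_iff, mem_union, not_or] at hz
    refine ⟨?_, fun h => P.curve_subset_support he h⟩
    rintro (h | h)
    · exact absurd h hz.1
    · simp only [mem_iUnion] at h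
      obtain ⟨f, hf, hzf⟩ := h
      by_cases hfe : f = e
      · exact hfe ▸ hzf
      · exact absurd (mem_biUnion (show f ∈ E(G) \ {e} from ⟨hf, hfe⟩) hzf) hz.2

theorem exists_isLocalSplit_of_mem_openSegment {e : β} (he : e ∈ E(G)) {i : ℕ}
    (hi : i < P.len e) {x : ℂ} (hx : x ∈ openSegment ℝ (P.corner e i) (P.corner e (i + 1))) :
    ∃ U A B, IsLocalSplit P.support x U A B ∧
      (∀ z ∈ A, ((z - x) / (x - P.corner e i)).im < 0) ∧
      ∀ z ∈ B, 0 < ((z - x) / (x - P.corner e i)).im := by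
  have hs := P.simple e he
  obtain ⟨V₁, hV₁, h₁⟩ := P.exists_nhds_mem_support_iff hV hE he (P.openSegment_subset he hi hx)
  obtain ⟨V₂, hV₂, h₂⟩ := hs.exists_nhds_of_mem_openSegment hi hx
  have hne : P.corner e i ≠ x := by
    rintro h
    rw [← h, left_mem_openSegment_iff] at hx
    exact hs.nondeg i hi hx
  obtain ⟨t, ht, hq⟩ := exists_sub_eq_mul_of_mem_openSegment hx
  have hd := sub_ne_zero.2 hne.symm
  have hdiv : (P.corner e (i + 1) - x) / (x - P.corner e i) = t := by rw [hq]; field_simp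
  have harg : Complex.arg t = 0 := Complex.arg_ofReal_of_nonneg ht.le
  obtain ⟨U, A, B, -, h, hA, hB⟩ := exists_isLocalSplit (Filter.inter_mem hV₁ hV₂)
    (fun z hz => (h₁ z hz.1).trans (h₂ z hz.2)) hne
    (by rw [hdiv]; exact Complex.ofReal_mem_slitPlane.2 ht)
  rw [hdiv, harg] at hA hB
  refine ⟨U, A, B, h, fun z hz => Complex.arg_neg_iff.1 (hA z hz), fun z hz => ?_⟩
  have := hB z hz
  -- A vanishing imaginary part would make the argument `0` or `π`, and both are excluded on `B`.
  rcases (Complex.arg_nonneg_iff.1 this.1.le).lt_or_eq with h0 | h0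
  · exact h0
  · rcases lt_or_ge ((z - x) / (x - P.corner e i)).re 0 with h3 | h3
    · exact absurd (Complex.arg_eq_pi_iff.2 ⟨h3, h0.symm⟩) this.2.ne
    · exact absurd (Complex.arg_eq_zero_iff.2 ⟨h3, h0.symm⟩) this.1.ne'

theorem exists_isLocalSplit_of_mem_curve {e : β} (he : e ∈ E(G)) {x : ℂ}
    (hx : x ∈ P.curve e \ P.pt '' V(G)) : ∃ U A B, IsLocalSplit P.support x U A B := by
  have hs := P.simple e he
  obtain ⟨h0, hn⟩ := P.ends_mem_pt_image he
  rcases IsSimplePoly.mem_openSegment_or_corner hx.1 (fun h => hx.2 (h ▸ h0))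
    (fun h => hx.2 (h ▸ hn)) with ⟨i, hi, hxi⟩ | ⟨j, hj, rfl⟩
  · obtain ⟨U, A, B, h, -⟩ := P.exists_isLocalSplit_of_mem_openSegment hV hE he hi hxi
    exact ⟨U, A, B, h⟩
  · obtain ⟨V₁, hV₁, h₁⟩ := P.exists_nhds_mem_support_iff hV hE he hx
    obtain ⟨V₂, hV₂, h₂⟩ := hs.exists_nhds_of_corner hj
    obtain ⟨U, A, B, -, h, -⟩ := exists_isLocalSplit (Filter.inter_mem hV₁ hV₂)
      (fun z hz => (h₁ z hz.1).trans (h₂ z hz.2)) (hs.nondeg j (by omega))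
      (hs.corner_div_mem_slitPlane hj)
    exact ⟨U, A, B, h⟩

/-! ### Faces -/

omit hV hE in
theorem subset_compl_of_mem_faces {F : Set ℂ} (hF : F ∈ P.faces) : F ⊆ P.supportᶜ := by
  obtain ⟨z, -, rfl⟩ := hF
  exact connectedComponentIn_subset _ _

omit hV hE in
theorem eq_connectedComponentIn {F : Set ℂ} (hF : F ∈ P.faces) {z : ℂ} (hz : z ∈ F) :
    F = connectedComponentIn P.supportᶜ z := by
  obtain ⟨w, -, rfl⟩ := hF
  exact connectedComponentIn_eq hz

omit hV hE in
theorem eq_of_mem_faces {F F' : Set ℂ} (hF : F ∈ P.faces) (hF' : F' ∈ P.faces) {z : ℂ}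
    (hz : z ∈ F) (hz' : z ∈ F') : F = F' :=
  (P.eq_connectedComponentIn hF hz).trans (P.eq_connectedComponentIn hF' hz').symm

omit hV hE in
theorem exists_face_superset {A : Set ℂ} (hA : IsPreconnected A) (hAs : A ⊆ P.supportᶜ)
    (hne : A.Nonempty) : ∃ F ∈ P.faces, A ⊆ F := by
  obtain ⟨a, ha⟩ := hne
  exact ⟨_, ⟨a, hAs ha, rfl⟩, hA.subset_connectedComponentIn ha hAs⟩

omit hV hE in
theorem exists_mem_face {z : ℂ} (hz : z ∉ P.support) : ∃ F ∈ P.faces, z ∈ F :=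
  ⟨_, ⟨z, hz, rfl⟩, mem_connectedComponentIn hz⟩

omit hV hE in
theorem nonempty_of_mem_faces {F : Set ℂ} (hF : F ∈ P.faces) : F.Nonempty := by
  obtain ⟨z, hz, rfl⟩ := hF
  exact ⟨z, mem_connectedComponentIn hz⟩

theorem isOpen_of_mem_faces {F : Set ℂ} (hF : F ∈ P.faces) : IsOpen F := by
  obtain ⟨z, -, rfl⟩ := hF
  exact (P.isClosed_support hV hE).isOpen_compl.connectedComponentIn

omit hV hE in
/-- The faces on both sides at a point that has a local split. -/
theorem exists_faces_of_isLocalSplit {x : ℂ} {U A B : Set ℂ} (h : IsLocalSplit P.support x U A B)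
    (hx : x ∈ P.support) : ∃ F ∈ P.faces, ∃ F' ∈ P.faces, A ⊆ F ∧ B ⊆ F' ∧
      ∀ y ∈ U ∩ P.support, ∀ H ∈ P.faces, y ∈ closure H ↔ H = F ∨ H = F' := by
  have hAB : ∀ z ∈ A ∪ B, z ∈ P.supportᶜ := fun z hz => by
    rw [← h.diff_eq] at hz
    exact hz.2
  obtain ⟨F, hF, hAF⟩ := P.exists_face_superset h.isPreconnected_left
    (fun z hz => hAB z (Or.inl hz)) (closure_nonempty_iff.1 ⟨x, h.subset_closure_left ⟨h.mem, hx⟩⟩)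
  obtain ⟨F', hF', hBF⟩ := P.exists_face_superset h.isPreconnected_right
    (fun z hz => hAB z (Or.inr hz)) (closure_nonempty_iff.1 ⟨x, h.subset_closure_right ⟨h.mem, hx⟩⟩)
  refine ⟨F, hF, F', hF', hAF, hBF, fun y hy H hH => ⟨fun hyH => ?_, ?_⟩⟩
  · obtain ⟨z, hzU, hzH⟩ := mem_closure_iff.1 hyH U h.isOpen hy.1
    have hz : z ∈ A ∪ B := h.diff_eq ▸ ⟨hzU, P.subset_compl_of_mem_faces hH hzH⟩
    rcases hz with hz | hz
    · exact Or.inl (P.eq_of_mem_faces hH hF hzH (hAF hz))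
    · exact Or.inr (P.eq_of_mem_faces hH hF' hzH (hBF hz))
  · rintro (rfl | rfl)
    · exact closure_mono hAF (h.subset_closure_left hy)
    · exact closure_mono hBF (h.subset_closure_right hy)

/-- The faces touching a point of an edge are the same all along a connected part of the edge. -/
theorem mem_closure_iff_of_isPreconnected {e : β} (he : e ∈ E(G)) {t : Set ℂ}
    (ht : IsPreconnected t) (hte : t ⊆ P.curve e \ P.pt '' V(G)) {x y : ℂ} (hx : x ∈ t)
    (hy : y ∈ t) : ∀ H ∈ P.faces, x ∈ closure H ↔ y ∈ closure H := by
  -- A local split yields one pair of faces for all nearby points of the edge, so the relation holds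
  -- locally, and connectedness spreads it.
  refine ht.induction₂' (fun x y => ∀ H ∈ P.faces, x ∈ closure H ↔ y ∈ closure H) ?_ ?_ hx hy
  · intro x hx
    obtain ⟨U, A, B, h⟩ := P.exists_isLocalSplit_of_mem_curve hV hE he (hte hx)
    have hxs := P.curve_subset_support he (hte hx).1
    obtain ⟨F, -, F', -, -, -, hFF⟩ := P.exists_faces_of_isLocalSplit h hxs
    filter_upwards [self_mem_nhdsWithin, mem_nhdsWithin_of_mem_nhds (h.isOpen.mem_nhds h.mem)]
      with y hyt hyU
    have := fun H hH => (hFF x ⟨h.mem, hxs⟩ H hH).trans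
      (hFF y ⟨hyU, P.curve_subset_support he (hte hyt).1⟩ H hH).symm
    exact ⟨this, fun H hH => (this H hH).symm⟩
  · exact fun x y z _ _ _ h₁ h₂ H hH => (h₁ H hH).trans (h₂ H hH)

/-- Walk along the edge one segment at a time: an open segment stays connected when an end corner is
added, and inner corners have local splits too. -/
theorem mem_closure_iff_of_mem_openSegment {e : β} (he : e ∈ E(G)) {i : ℕ} (hi : i < P.len e)
    {x y : ℂ} (hx : x ∈ openSegment ℝ (P.corner e 0) (P.corner e 1))
    (hy : y ∈ openSegment ℝ (P.corner e i) (P.corner e (i + 1))) :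
    ∀ H ∈ P.faces, x ∈ closure H ↔ y ∈ closure H := by
  induction i generalizing y with
  | zero =>
    exact P.mem_closure_iff_of_isPreconnected hV hE he (convex_openSegment _ _).isPreconnected
      (P.openSegment_subset he hi) hx hy
  | succ j ih =>
    have key : ∀ k, k < P.len e → (k = j ∨ k = j + 1) →
        ∀ z ∈ openSegment ℝ (P.corner e k) (P.corner e (k + 1)),
        ∀ H ∈ P.faces, z ∈ closure H ↔ P.corner e (j + 1) ∈ closure H := by
      intro k hk hkj z hz
      refine P.mem_closure_iff_of_isPreconnected hV hE he
        (t := insert (P.corner e (j + 1)) (openSegment ℝ (P.corner e k) (P.corner e (k + 1))))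
        ((convex_openSegment _ _).isPreconnected.subset_closure (subset_insert _ _) ?_)
        (insert_subset (P.corner_mem he hi) (P.openSegment_subset he hk))
        (mem_insert_of_mem _ hz) (mem_insert _ _)
      refine insert_subset ?_ subset_closure
      rw [closure_openSegment]
      rcases hkj with rfl | rfl
      · exact right_mem_segment ℝ _ _
      · exact left_mem_segment ℝ _ _
    obtain ⟨w, hw⟩ : (openSegment ℝ (P.corner e j) (P.corner e (j + 1))).Nonempty :=
      ⟨_, 1 / 2, 1 / 2, by norm_num, by norm_num, by norm_num, rfl⟩
    intro H hH
    exact (ih (by omega) hw H hH).trans ((key j (by omega) (Or.inl rfl) w hw H hH).trans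
      (key (j + 1) hi (Or.inr rfl) y hy H hH).symm)

/-- This makes the incidence in the dual local: a face touching the edge at one inner point touches
every open segment of it, hence its closure contains the whole edge. Faces are disjoint from the
drawing, so closure and frontier agree there. -/
theorem curve_subset_frontier_iff {e : β} (he : e ∈ E(G)) {i : ℕ} (hi : i < P.len e) {x : ℂ}
    (hx : x ∈ openSegment ℝ (P.corner e i) (P.corner e (i + 1))) {H : Set ℂ} (hH : H ∈ P.faces) :
    P.curve e ⊆ frontier H ↔ x ∈ closure H := by
  constructor
  · intro h
    exact frontier_subset_closure (h (P.openSegment_subset he hi hx).1)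
  · intro h z hz
    obtain ⟨w, hw⟩ : (openSegment ℝ (P.corner e 0) (P.corner e 1)).Nonempty :=
      ⟨_, 1 / 2, 1 / 2, by norm_num, by norm_num, by norm_num, rfl⟩
    have hwH := (P.mem_closure_iff_of_mem_openSegment hV hE he hi hw hx H hH).2 h
    rw [(P.isOpen_of_mem_faces hV hE hH).frontier_eq]
    refine ⟨?_, fun hzH => P.subset_compl_of_mem_faces hH hzH (P.curve_subset_support he hz)⟩
    obtain ⟨j, hj, hzj⟩ := mem_polyCurve.1 hz
    rw [← closure_openSegment] at hzj
    refine closure_minimal (fun y hy => ?_) isClosed_closure hzj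
    exact (P.mem_closure_iff_of_mem_openSegment hV hE he hj hw hy H hH).1 hwH

/-- At a point `x` in the interior of a segment of the edge `e`, the two sides `A` and `B` of the
edge belong to the ends of the dual edge. -/
theorem exists_split_isLink {e : β} (he : e ∈ E(G)) {i : ℕ} (hi : i < P.len e) {x : ℂ}
    (hx : x ∈ openSegment ℝ (P.corner e i) (P.corner e (i + 1))) :
    ∃ U A B F F', IsLocalSplit P.support x U A B ∧
      (∀ z ∈ A, ((z - x) / (x - P.corner e i)).im < 0) ∧
      (∀ z ∈ B, 0 < ((z - x) / (x - P.corner e i)).im) ∧ P.dual.IsLink e F F' ∧ A ⊆ F ∧ B ⊆ F' ∧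
      ∀ y ∈ U ∩ P.support, ∀ H ∈ P.faces, y ∈ closure H ↔ H = F ∨ H = F' := by
  obtain ⟨U, A, B, h, hA, hB⟩ := P.exists_isLocalSplit_of_mem_openSegment hV hE he hi hx
  have hxs := P.curve_subset_support he (P.openSegment_subset he hi hx).1
  obtain ⟨F, hF, F', hF', hAF, hBF, hFF⟩ := P.exists_faces_of_isLocalSplit h hxs
  refine ⟨U, A, B, F, F', h, hA, hB, ⟨he, hF, hF', fun H hH => ?_⟩, hAF, hBF, hFF⟩
  rw [P.curve_subset_frontier_iff hV hE he hi hx hH]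
  exact hFF x ⟨h.mem, hxs⟩ H hH

theorem dual_edgeSet : E(P.dual) = E(G) := by
  ext e
  rw [P.dual.edge_mem_iff_exists_isLink]
  refine ⟨fun ⟨F, F', h⟩ => h.1, fun he => ?_⟩
  obtain ⟨w, hw⟩ : (openSegment ℝ (P.corner e 0) (P.corner e 1)).Nonempty :=
    ⟨_, 1 / 2, 1 / 2, by norm_num, by norm_num, by norm_num, rfl⟩
  obtain ⟨-, -, -, F, F', -, -, -, h, -⟩ :=
    P.exists_split_isLink hV hE he (P.simple e he).pos hw
  exact ⟨F, F', h⟩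

end PlaneEmbedding

namespace PlaneEmbedding

variable {α β : Type*} {G : Graph α β} (P : PlaneEmbedding G)

/-! ### Finiteness of the set of faces, connectedness of the dual -/

/-- The vertices and the corners of the edges. -/
def nodes : Set ℂ := P.pt '' V(G) ∪ ⋃ e ∈ E(G), P.corner e '' Iic (P.len e)

theorem corner_mem_curve {e : β} (he : e ∈ E(G)) {i : ℕ} (hi : i ≤ P.len e) :
    P.corner e i ∈ P.curve e := by
  have h0 := (P.simple e he).pos
  rcases i with _ | i
  · exact P.segment_subset_curve h0 (left_mem_segment ℝ _ _)
  · exact P.segment_subset_curve hi (right_mem_segment ℝ _ _)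

theorem nodes_subset_support : P.nodes ⊆ P.support := by
  refine union_subset_union_right _ (iUnion₂_mono fun e he => ?_)
  rintro _ ⟨i, hi, rfl⟩
  exact P.corner_mem_curve he hi

theorem exists_mem_openSegment {z : ℂ} (hz : z ∈ P.support) (hzn : z ∉ P.nodes) :
    ∃ e ∈ E(G), ∃ i < P.len e, z ∈ openSegment ℝ (P.corner e i) (P.corner e (i + 1)) := by
  rw [nodes, mem_union, not_or] at hzn
  rcases hz with hz | hz
  · exact absurd hz hzn.1
  simp only [mem_iUnion] at hz
  obtain ⟨e, he, hze⟩ := hz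
  have hne : ∀ i ≤ P.len e, z ≠ P.corner e i := by
    rintro i hi rfl
    exact hzn.2 (mem_biUnion he ⟨i, hi, rfl⟩)
  rcases IsSimplePoly.mem_openSegment_or_corner hze (hne 0 (Nat.zero_le _)) (hne _ le_rfl) with
    ⟨i, hi, h⟩ | ⟨j, hj, h⟩
  · exact ⟨e, he, i, hi, h⟩
  · exact absurd h (hne _ hj.le)

variable (hV : V(G).Finite) (hE : E(G).Finite)
include hV hE

theorem finite_nodes : P.nodes.Finite :=
  (hV.image _).union (hE.biUnion fun _ _ => (finite_Iic _).image _)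

theorem isPreconnected_compl_nodes : IsPreconnected P.nodesᶜ :=
  ((P.finite_nodes hV hE).countable.isPathConnected_compl_of_one_lt_rank
    (by rw [Complex.rank_real_complex]; exact Nat.one_lt_ofNat)).isConnected.isPreconnected

theorem mem_of_mem_closure {F : Set ℂ} (hF : F ∈ P.faces) {z : ℂ} (hz : z ∉ P.support)
    (hzF : z ∈ closure F) : z ∈ F := by
  obtain ⟨F', hF', hzF'⟩ := P.exists_mem_face hz
  obtain ⟨w, hw, hwF⟩ := mem_closure_iff.1 hzF F' (P.isOpen_of_mem_faces hV hE hF') hzF'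
  rwa [P.eq_of_mem_faces hF hF' hwF hw]

/-- Unless a face contains the whole complement of the nodes, connectedness of that complement
provides a boundary point of the face that is not a node. This point lies on an edge, and each of
the finitely many edges bounds at most two faces. -/
theorem finite_faces : P.faces.Finite := by
  have h : P.faces ⊆ {H ∈ P.faces | P.nodesᶜ ⊆ H} ∪
      ⋃ e ∈ E(G), {H ∈ P.faces | P.curve e ⊆ frontier H} := by
    intro H hH
    by_cases hn : P.nodesᶜ ⊆ H
    · exact Or.inl ⟨hH, hn⟩
    right
    obtain ⟨z, hz, hzH⟩ : ∃ z, z ∈ closure H \ H ∧ z ∉ P.nodes := by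
      by_contra! hcl
      refine hn ((P.isPreconnected_compl_nodes hV hE).subset_left_of_subset_union
        (P.isOpen_of_mem_faces hV hE hH) isClosed_closure.isOpen_compl
        (disjoint_compl_right.mono_left subset_closure) ?_ ?_)
      · intro z hz
        by_contra hzu
        rw [mem_union, not_or, mem_compl_iff, not_not] at hzu
        exact hz (hcl z ⟨hzu.2, hzu.1⟩)
      · obtain ⟨z, hz⟩ := P.nonempty_of_mem_faces hH
        exact ⟨z, fun h => P.subset_compl_of_mem_faces hH hz (P.nodes_subset_support h), hz⟩
    have hzs : z ∈ P.support := by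
      by_contra hzs
      exact hz.2 (P.mem_of_mem_closure hV hE hH hzs hz.1)
    obtain ⟨e, he, i, hi, hzi⟩ := P.exists_mem_openSegment hzs hzH
    exact mem_biUnion he ⟨hH, (P.curve_subset_frontier_iff hV hE he hi hzi hH).2 hz.1⟩
  refine (Set.Finite.union ?_ (hE.biUnion fun e he => ?_)).subset h
  · obtain ⟨z, hz⟩ := (P.finite_nodes hV hE).infinite_compl.nonempty
    exact Set.Subsingleton.finite fun H hH H' hH' =>
      P.eq_of_mem_faces hH.1 hH'.1 (hH.2 hz) (hH'.2 hz)
  · have he' := he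
    rw [← P.dual_edgeSet hV hE, P.dual.edge_mem_iff_exists_isLink] at he'
    obtain ⟨F, F', -, -, -, hFF⟩ := he'
    exact (Set.toFinite {F, F'}).subset fun H hH => (hFF H hH.1).1 hH.2

/-- At an inner point of a segment only the two ends of the dual edge are near, and `Q` holds for
both or neither. Applied to `Q` and to its negation, this separates the complement of the nodes into
two open sets. -/
theorem isOpen_setOf_mem_closure {Q : Set ℂ → Prop}
    (hQ : ∀ e F F', P.dual.IsLink e F F' → (Q F ↔ Q F')) :
    IsOpen {z | z ∉ P.nodes ∧ ∃ H ∈ P.faces, Q H ∧ z ∈ closure H} := by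
  rw [isOpen_iff_mem_nhds]
  rintro z ⟨hzn, H, hH, hQH, hzH⟩
  by_cases hzs : z ∈ P.support
  · obtain ⟨e, he, i, hi, hzi⟩ := P.exists_mem_openSegment hzs hzn
    obtain ⟨U, A, B, F, F', h, -, -, hl, hAF, hBF, hFF⟩ := P.exists_split_isLink hV hE he hi hzi
    have hQF : Q F ∧ Q F' := by
      rcases (hFF z ⟨h.mem, hzs⟩ H hH).1 hzH with rfl | rfl
      · exact ⟨hQH, (hQ e _ _ hl).1 hQH⟩
      · exact ⟨(hQ e _ _ hl).2 hQH, hQH⟩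
    filter_upwards [h.isOpen.mem_nhds h.mem,
      (P.finite_nodes hV hE).isClosed.isOpen_compl.mem_nhds hzn] with w hwU hwn
    refine ⟨hwn, ?_⟩
    by_cases hws : w ∈ P.support
    · exact ⟨F, hl.left_mem, hQF.1, (hFF w ⟨hwU, hws⟩ F hl.left_mem).2 (Or.inl rfl)⟩
    · have hw : w ∈ A ∪ B := h.diff_eq ▸ ⟨hwU, hws⟩
      rcases hw with hw | hw
      · exact ⟨F, hl.left_mem, hQF.1, subset_closure (hAF hw)⟩
      · exact ⟨F', hl.right_mem, hQF.2, subset_closure (hBF hw)⟩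
  · filter_upwards [(P.isOpen_of_mem_faces hV hE hH).mem_nhds
      (P.mem_of_mem_closure hV hE hH hzs hzH)] with w hw
    exact ⟨fun h => P.subset_compl_of_mem_faces hH hw (P.nodes_subset_support h), H, hH, hQH,
      subset_closure hw⟩

/-- The dual graph is connected. -/
theorem dual_induction {Q : Set ℂ → Prop}
    (hQ : ∀ e F F', P.dual.IsLink e F F' → (Q F ↔ Q F')) {F F' : Set ℂ} (hF : F ∈ P.faces)
    (hF' : F' ∈ P.faces) (hQF : Q F) : Q F' := by
  by_contra hQF'
  have hn : ∀ {H}, H ∈ P.faces → ∀ z ∈ H, z ∉ P.nodes := fun hH z hz h =>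
    P.subset_compl_of_mem_faces hH hz (P.nodes_subset_support h)
  have hdisj : Disjoint {z | z ∉ P.nodes ∧ ∃ H ∈ P.faces, Q H ∧ z ∈ closure H}
      {z | z ∉ P.nodes ∧ ∃ H ∈ P.faces, ¬ Q H ∧ z ∈ closure H} := by
    rw [Set.disjoint_left]
    rintro z ⟨hzn, H, hH, hQH, hzH⟩ ⟨-, K, hK, hQK, hzK⟩
    by_cases hzs : z ∈ P.support
    · obtain ⟨e, he, i, hi, hzi⟩ := P.exists_mem_openSegment hzs hzn
      obtain ⟨U, A, B, L, L', h, -, -, hl, -, -, hLL⟩ := P.exists_split_isLink hV hE he hi hzi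
      have hQL := hQ e _ _ hl
      rcases (hLL z ⟨h.mem, hzs⟩ H hH).1 hzH with rfl | rfl <;>
        rcases (hLL z ⟨h.mem, hzs⟩ K hK).1 hzK with rfl | rfl <;> tauto
    · have := P.eq_of_mem_faces hH hK (P.mem_of_mem_closure hV hE hH hzs hzH)
        (P.mem_of_mem_closure hV hE hK hzs hzK)
      exact hQK (this ▸ hQH)
  have hsub := (P.isPreconnected_compl_nodes hV hE).subset_left_of_subset_union
    (P.isOpen_setOf_mem_closure hV hE hQ)
    (P.isOpen_setOf_mem_closure hV hE fun e F F' h => not_congr (hQ e F F' h)) hdisj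
    (fun z hz => ?_) ?_
  · obtain ⟨z, hz⟩ := P.nonempty_of_mem_faces hF'
    exact Set.disjoint_left.1 hdisj (hsub (hn hF' z hz))
      ⟨hn hF' z hz, F', hF', hQF', subset_closure hz⟩
  · obtain ⟨H, hH, hzH⟩ : ∃ H ∈ P.faces, z ∈ closure H := by
      by_cases hzs : z ∈ P.support
      · obtain ⟨e, he, i, hi, hzi⟩ := P.exists_mem_openSegment hzs hz
        obtain ⟨U, A, B, L, L', h, -, -, hl, -, -, hLL⟩ := P.exists_split_isLink hV hE he hi hzi
        exact ⟨L, hl.left_mem, (hLL z ⟨h.mem, hzs⟩ L hl.left_mem).2 (Or.inl rfl)⟩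
      · obtain ⟨H, hH, hzH⟩ := P.exists_mem_face hzs
        exact ⟨H, hH, subset_closure hzH⟩
    by_cases hQH : Q H
    · exact Or.inl ⟨hz, H, hH, hQH, hzH⟩
    · exact Or.inr ⟨hz, H, hH, hQH, hzH⟩
  · obtain ⟨z, hz⟩ := P.nonempty_of_mem_faces hF
    exact ⟨z, hn hF z hz, hn hF z hz, F, hF, hQF, subset_closure hz⟩

theorem nonempty_faces : P.faces.Nonempty := by
  have hdense : P.nodesᶜ.Nonempty := (P.finite_nodes hV hE).infinite_compl.nonempty
  obtain ⟨z, hz⟩ := hdense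
  by_cases hzs : z ∈ P.support
  · obtain ⟨e, he, i, hi, hzi⟩ := P.exists_mem_openSegment hzs hz
    obtain ⟨-, -, -, F, _, -, -, -, hl, -⟩ := P.exists_split_isLink hV hE he hi hzi
    exact ⟨F, hl.left_mem⟩
  · obtain ⟨H, hH, -⟩ := P.exists_mem_face hzs
    exact ⟨H, hH⟩

end PlaneEmbedding

/-! ### Even sets of edges and the high-temperature expansion -/

section Expansion

variable {ι V F : Type*} [Fintype V] [DecidableEq V] (src tgt : ι → V)

/-- The degree of `v` in the graph with edge set `T`; loops count twice. -/
def degIn (T : Finset ι) (v : V) : ℕ :=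
  ∑ e ∈ T, ((if src e = v then 1 else 0) + (if tgt e = v then 1 else 0))

/-- Double counting of edge ends, used for spins and for the linear factors `pt v - z`. Counting
loops twice matches both uses. -/
theorem prod_ends {M : Type*} [CommMonoid M] (T : Finset ι) (g : V → M) :
    ∏ e ∈ T, (g (src e) * g (tgt e)) = ∏ v, g v ^ degIn src tgt T v := by
  simp only [degIn, ← Finset.prod_pow_eq_pow_sum]
  rw [Finset.prod_comm]
  refine Finset.prod_congr rfl fun e _ => ?_
  simp only [pow_add, Finset.prod_mul_distrib, pow_ite, pow_one, pow_zero, Finset.prod_ite_eq,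
    Finset.mem_univ, if_true]

theorem sum_units_pow (n : ℕ) : ∑ s : ℤˣ, (s : ℝ) ^ n = if Even n then 2 else 0 := by
  have : (Finset.univ : Finset ℤˣ) = {1, -1} := rfl
  rw [this, Finset.sum_pair (by decide)]
  split_ifs with h
  · simp [h.neg_one_pow]; norm_num
  · simp [(Nat.not_even_iff_odd.1 h).neg_one_pow]

/-- The sum factorises over vertices, and `v` contributes `1 + (-1) ^ deg v`. -/
theorem sum_prod_ends (T : Finset ι) :
    ∑ τ : V → ℤˣ, ∏ e ∈ T, ((τ (src e) * τ (tgt e) : ℤˣ) : ℝ)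
      = if ∀ v, Even (degIn src tgt T v) then 2 ^ Fintype.card V else 0 := by
  have h : ∀ τ : V → ℤˣ, ∏ e ∈ T, ((τ (src e) * τ (tgt e) : ℤˣ) : ℝ)
      = ∏ v, (τ v : ℝ) ^ degIn src tgt T v := fun τ => by
    rw [← prod_ends src tgt T fun v => ((τ v : ℤˣ) : ℝ)]
    push_cast
    rfl
  simp only [h]
  rw [← Fintype.piFinset_univ, ← Finset.prod_univ_sum (fun _ => Finset.univ)
    (fun v (s : ℤˣ) => (s : ℝ) ^ degIn src tgt T v)]
  simp only [sum_units_pow]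
  split_ifs with hT
  · rw [Finset.prod_congr rfl fun v _ => if_pos (hT v)]
    simp
  · push Not at hT
    obtain ⟨v, hv⟩ := hT
    exact Finset.prod_eq_zero (Finset.mem_univ v) (by simpa using hv)

variable [Fintype ι] [DecidableEq ι] [Fintype F] [DecidableEq F] [Nonempty F] (dsrc dtgt : ι → F)

/-- Duality of the partition functions of Ising models with an arbitrary edge weight
`a e + b e * s` for the product `s` of the spins at the ends of `e`, when the even subsets of the
edges are the cuts of a connected dual graph. -/
theorem two_mul_sum_prod_eq
    (hcut : ∀ T : Finset ι, (∀ v, Even (degIn src tgt T v)) ↔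
      ∃ τ : F → ℤˣ, ∀ e, τ (dsrc e) * τ (dtgt e) = if e ∈ T then -1 else 1)
    (hconn : ∀ τ : F → ℤˣ, (∀ e, τ (dsrc e) * τ (dtgt e) = 1) → ∀ f f', τ f = τ f')
    (a b : ι → ℝ) :
    2 * ∑ τ : V → ℤˣ, ∏ e, (a e + b e * ((τ (src e) * τ (tgt e) : ℤˣ) : ℝ))
      = 2 ^ Fintype.card V *
        ∑ τ : F → ℤˣ, ∏ e, if τ (dsrc e) * τ (dtgt e) = 1 then a e else b e := by
  have hleft : ∑ τ : V → ℤˣ, ∏ e, (a e + b e * ((τ (src e) * τ (tgt e) : ℤˣ) : ℝ))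
      = ∑ T : Finset ι, (if ∀ v, Even (degIn src tgt T v) then 2 ^ Fintype.card V else 0) *
        ((∏ e ∈ T, b e) * ∏ e ∈ Finset.univ \ T, a e) := by
    simp only [add_comm (a _), Finset.prod_add, Finset.powerset_univ]
    rw [Finset.sum_comm]
    refine Finset.sum_congr rfl fun T _ => ?_
    rw [← sum_prod_ends, Finset.sum_mul]
    refine Finset.sum_congr rfl fun τ _ => ?_
    rw [Finset.prod_mul_distrib]
    ring
  have hright : ∑ τ : F → ℤˣ, (∏ e, if τ (dsrc e) * τ (dtgt e) = 1 then a e else b e)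
      = ∑ T : Finset ι, (if ∀ v, Even (degIn src tgt T v) then 2 else 0) *
        ((∏ e ∈ T, b e) * ∏ e ∈ Finset.univ \ T, a e) := by
    -- Group the configurations on `F` by the set of edges across which the spin changes.
    rw [← Finset.sum_fiberwise_of_maps_to (s := Finset.univ) (t := Finset.univ)
      (g := fun τ : F → ℤˣ => Finset.univ.filter fun e => τ (dsrc e) * τ (dtgt e) ≠ 1)
      (fun _ _ => Finset.mem_univ _)]
    refine Finset.sum_congr rfl fun T _ => ?_
    have hiff : ∀ τ : F → ℤˣ, (Finset.univ.filter fun e => τ (dsrc e) * τ (dtgt e) ≠ 1) = T ↔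
        ∀ e, τ (dsrc e) * τ (dtgt e) = if e ∈ T then -1 else 1 := by
      intro τ
      rw [Finset.ext_iff]
      refine forall_congr' fun e => ?_
      rw [Finset.mem_filter]
      rcases Int.units_eq_one_or (τ (dsrc e) * τ (dtgt e)) with h | h <;>
        by_cases heT : e ∈ T <;> simp [h, heT]
    have hterm : ∀ τ ∈ (Finset.univ.filter fun τ : F → ℤˣ =>
        (Finset.univ.filter fun e => τ (dsrc e) * τ (dtgt e) ≠ 1) = T),
        (∏ e, if τ (dsrc e) * τ (dtgt e) = 1 then a e else b e)
          = (∏ e ∈ T, b e) * ∏ e ∈ Finset.univ \ T, a e := by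
      intro τ hτ
      rw [Finset.mem_filter, hiff] at hτ
      rw [← Finset.prod_sdiff (Finset.subset_univ T), mul_comm]
      congr 1 <;> refine Finset.prod_congr rfl fun e he => ?_
      · rw [hτ.2 e, if_pos he, if_neg (by decide)]
      · rw [hτ.2 e, if_neg (Finset.mem_sdiff.1 he).2, if_pos rfl]
    rw [Finset.sum_congr rfl hterm, Finset.sum_const, nsmul_eq_mul]
    congr 1
    split_ifs with hT
    · obtain ⟨τ, hτ⟩ := (hcut T).1 hT
      have hfib : (Finset.univ.filter fun τ : F → ℤˣ =>
          (Finset.univ.filter fun e => τ (dsrc e) * τ (dtgt e) ≠ 1) = T) = {τ, -τ} := by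
        ext ρ
        simp only [Finset.mem_filter, Finset.mem_univ, true_and, Finset.mem_insert,
          Finset.mem_singleton]
        rw [hiff]
        constructor
        · intro hρ
          -- Two configurations with the same cut have a product without any jump, which is a global
          -- sign by connectedness.
          have hc := hconn (ρ * τ) fun e => by
            have : (ρ * τ) (dsrc e) * (ρ * τ) (dtgt e)
                = (ρ (dsrc e) * ρ (dtgt e)) * (τ (dsrc e) * τ (dtgt e)) := by
              simp only [Pi.mul_apply]; exact mul_mul_mul_comm _ _ _ _
            rw [this, hρ, hτ]
            exact Int.units_mul_self _
          obtain ⟨f₀⟩ := ‹Nonempty F›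
          have hρτ : ∀ f, ρ f = (ρ f₀ * τ f₀) * τ f := fun f => by
            have h1 := hc f₀ f
            simp only [Pi.mul_apply] at h1
            rw [h1, mul_assoc, Int.units_mul_self, mul_one]
          rcases Int.units_eq_one_or (ρ f₀ * τ f₀) with h | h <;> rw [h] at hρτ
          · exact Or.inl (funext fun f => by rw [hρτ f, one_mul])
          · exact Or.inr (funext fun f => by rw [hρτ f, neg_one_mul, Pi.neg_apply])
        · rintro (rfl | rfl)
          · exact hτ
          · intro e
            rw [Pi.neg_apply, Pi.neg_apply, neg_mul_neg, hτ]
      rw [hfib, Finset.card_pair]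
      · norm_num
      · intro h
        obtain ⟨f₀⟩ := ‹Nonempty F›
        have h1 := congrFun h f₀
        rw [Pi.neg_apply] at h1
        rcases Int.units_eq_one_or (τ f₀) with h2 | h2 <;> rw [h2] at h1 <;>
          exact absurd h1 (by decide)
    · rw [Nat.cast_eq_zero, Finset.card_eq_zero, Finset.filter_eq_empty_iff]
      intro τ _ hτ
      exact hT ((hcut T).2 ⟨τ, (hiff τ).1 hτ⟩)
  rw [hleft, hright, Finset.mul_sum, Finset.mul_sum]
  refine Finset.sum_congr rfl fun T _ => ?_
  split_ifs <;> ring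

end Expansion

namespace PlaneEmbedding

variable {α β : Type*} {G : Graph α β} (P : PlaneEmbedding G)

/-! ### Cuts of the dual graph are the even subgraphs -/

/-- The vertex where the curve of `e` begins. -/
def src (e : E(G)) : V(G) :=
  ⟨(P.exists_isLink_corner e.2).choose,
    (P.exists_isLink_corner e.2).choose_spec.choose_spec.1.left_mem⟩

/-- The vertex where the curve of `e` ends. -/
def tgt (e : E(G)) : V(G) :=
  ⟨(P.exists_isLink_corner e.2).choose_spec.choose,
    (P.exists_isLink_corner e.2).choose_spec.choose_spec.1.right_mem⟩

theorem isLink_src_tgt (e : E(G)) : G.IsLink e (P.src e) (P.tgt e) :=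
  (P.exists_isLink_corner e.2).choose_spec.choose_spec.1

theorem corner_zero (e : E(G)) : P.corner e 0 = P.pt (P.src e) :=
  (P.exists_isLink_corner e.2).choose_spec.choose_spec.2.1

theorem corner_len (e : E(G)) : P.corner e (P.len e) = P.pt (P.tgt e) :=
  (P.exists_isLink_corner e.2).choose_spec.choose_spec.2.2

/-- The product over `e ∈ T` of the square roots with branch cuts along the edges. -/
def prodRoot (T : Finset E(G)) (z : ℂ) : ℂ := ∏ e ∈ T, polyRoot (P.len e) (P.corner e) z

theorem continuousAt_prodRoot {T : Finset E(G)} {z : ℂ} (hz : ∀ e ∈ T, z ∉ P.curve e) :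
    ContinuousAt (P.prodRoot T) z :=
  tendsto_finsetProd _ fun e he => continuousAt_polyRoot (hz e he)

theorem continuousAt_prodRoot_of_notMem {T : Finset E(G)} {z : ℂ} (hz : z ∉ P.support) :
    ContinuousAt (P.prodRoot T) z :=
  P.continuousAt_prodRoot fun e _ h => hz (P.curve_subset_support e.2 h)

theorem prodRoot_sq [Fintype V(G)] [DecidableEq V(G)] (T : Finset E(G)) {z : ℂ}
    (hz : z ∉ P.support) :
    P.prodRoot T z ^ 2 = ∏ v : V(G), (P.pt v - z) ^ degIn P.src P.tgt T v := by
  rw [prodRoot, ← Finset.prod_pow, ← prod_ends P.src P.tgt T fun v => P.pt v - z]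
  refine Finset.prod_congr rfl fun e _ => ?_
  rw [polyRoot_sq, corner_zero, corner_len]
  rintro i hi rfl
  exact hz (P.curve_subset_support e.2 (P.corner_mem_curve e.2 hi))

open scoped Classical in
/-- The square root changes its sign exactly across the edges in `T`. -/
theorem exists_prodRoot_flip (T : Finset E(G)) (e : E(G)) {i : ℕ} (hi : i < P.len e) {x : ℂ}
    (hx : x ∈ openSegment ℝ (P.corner e i) (P.corner e (i + 1))) :
    ∃ g : ℂ → ℂ, ContinuousAt g x ∧
      (∀ z, ((z - x) / (x - P.corner e i)).im < 0 →
        P.prodRoot T z = (((if e ∈ T then -1 else 1 : ℤˣ) : ℤ) : ℂ) * g z) ∧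
      ∀ z, 0 < ((z - x) / (x - P.corner e i)).im → P.prodRoot T z = g z := by
  have hxe := P.openSegment_subset e.2 hi hx
  have hne : ∀ f : E(G), f ≠ e → x ∉ P.curve f := fun f hf hxf =>
    hxe.2 (P.inter_subset f f.2 e e.2 (fun h => hf (Subtype.ext h)) ⟨hxf, hxe.1⟩)
  by_cases heT : e ∈ T
  · obtain ⟨s, hs, hneg, hpos⟩ := (P.simple e e.2).exists_polyRoot_flip hi hx
    have hsplit : ∀ z, P.prodRoot T z
        = polyRoot (P.len e) (P.corner e) z * P.prodRoot (T.erase e) z := fun z =>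
      (Finset.mul_prod_erase _ _ heT).symm
    refine ⟨fun z => s z * P.prodRoot (T.erase e) z,
      hs.mul (P.continuousAt_prodRoot fun f hf => hne f (Finset.ne_of_mem_erase hf)),
      fun z hz => ?_, fun z hz => ?_⟩
    · rw [hsplit, hneg z hz, if_pos heT]
      push_cast
      ring
    · rw [hsplit, hpos z hz]
  · refine ⟨P.prodRoot T, P.continuousAt_prodRoot fun f hf => hne f ?_, fun z _ => ?_,
      fun z _ => rfl⟩
    · rintro rfl
      exact heT hf
    · simp [heT]

theorem eq_of_forall_mem_of_continuousAt {g : ℂ → ℂ} {x a : ℂ} {A : Set ℂ} (hg : ContinuousAt g x)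
    (hA : ∀ z ∈ A, g z = a) (hx : x ∈ closure A) : g x = a := by
  have h := hg.continuousWithinAt.mem_closure_image hx
  have h2 : g '' A ⊆ {a} := by
    rintro _ ⟨z, hz, rfl⟩
    exact hA z hz
  simpa using closure_mono h2 h

variable (hV : V(G).Finite) (hE : E(G).Finite)
include hV hE

open scoped Classical in
/-- Every even set of edges is a cut of the dual graph. -/
theorem exists_coloring [Fintype V(G)] (T : Finset E(G))
    (hT : ∀ v, Even (degIn P.src P.tgt T v)) :
    ∃ τ : V(P.dual) → ℤˣ, ∀ (e : E(G)) (F F' : V(P.dual)), P.dual.IsLink e F F' →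
      τ F * τ F' = if e ∈ T then -1 else 1 := by
  choose k hk using hT
  set R : ℂ → ℂ := fun z => ∏ v : V(G), (P.pt v - z) ^ k v with hR
  have hRc : Continuous R := by fun_prop
  have hR0 : ∀ z, z ∉ P.pt '' V(G) → R z ≠ 0 := fun z hz =>
    Finset.prod_ne_zero_iff.2 fun v _ => pow_ne_zero _ (sub_ne_zero.2 fun h => hz ⟨v, v.2, h⟩)
  have hptz : ∀ {z}, z ∉ P.support → z ∉ P.pt '' V(G) := fun hz h => hz (Or.inl h)
  -- Halving the even degrees gives a second square root `R`, continuous on the whole plane; the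
  -- ratio `c` squares to `1` off the drawing.
  set c : ℂ → ℂ := fun z => P.prodRoot T z / R z with hc
  have hcsq : ∀ z, z ∉ P.support → c z ^ 2 = 1 := by
    intro z hz
    have h : P.prodRoot T z ^ 2 = R z ^ 2 := by
      rw [P.prodRoot_sq T hz, hR]
      simp only [hk]
      rw [← Finset.prod_pow]
      exact Finset.prod_congr rfl fun v _ => by ring
    rw [hc]
    simp only
    rw [div_pow, h, div_self (pow_ne_zero 2 (hR0 z (hptz hz)))]
  have hconst : ∀ F ∈ P.faces, (∀ z ∈ F, c z = 1) ∨ ∀ z ∈ F, c z = -1 := by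
    intro F hF
    have hFs := P.subset_compl_of_mem_faces hF
    have hpre : IsPreconnected F := by
      obtain ⟨z, -, rfl⟩ := hF
      exact isPreconnected_connectedComponentIn
    refine hpre.eq_or_eq_neg_of_sq_eq (f := c) (g := fun _ => 1) (fun z hz => ?_)
      continuousOn_const (fun z hz => ?_) (fun _ => one_ne_zero)
    · exact ((P.continuousAt_prodRoot_of_notMem (hFs hz)).div hRc.continuousAt
        (hR0 z (hptz (hFs hz)))).continuousWithinAt
    · simpa using hcsq z (hFs hz)
  have hcol : ∀ F : V(P.dual), ∃ u : ℤˣ, ∀ z ∈ F.1, c z = ((u : ℤ) : ℂ) := by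
    intro F
    rcases hconst F F.2 with h | h
    · exact ⟨1, by simpa using h⟩
    · exact ⟨-1, by simpa using h⟩
  choose τ hτ using hcol
  refine ⟨τ, fun e F F' hFF' => ?_⟩
  obtain ⟨x, hx⟩ : (openSegment ℝ (P.corner e 0) (P.corner e 1)).Nonempty :=
    ⟨_, 1 / 2, 1 / 2, by norm_num, by norm_num, by norm_num, rfl⟩
  have h0 := (P.simple e e.2).pos
  obtain ⟨U, A, B, L, L', h, hA, hB, hl, hAL, hBL, -⟩ := P.exists_split_isLink hV hE e.2 h0 hx
  have hxe := P.openSegment_subset e.2 h0 hx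
  have hxs := P.curve_subset_support e.2 hxe.1
  obtain ⟨g, hg, hneg, hpos⟩ := P.exists_prodRoot_flip T e h0 hx
  have hgR : ContinuousAt (fun z => g z / R z) x := hg.div hRc.continuousAt (hR0 x hxe.2)
  -- Both colours are read off as limits at `x`: from `B` the limit is `g x / R x`, from `A` the
  -- same number times the sign of the jump.
  have key : ∀ K K' : V(P.dual), A ⊆ K.1 → B ⊆ K'.1 → τ K * τ K' = if e ∈ T then -1 else 1 := by
    intro K K' hAK hBK
    have h2 : g x / R x = ((τ K' : ℤ) : ℂ) := by
      refine eq_of_forall_mem_of_continuousAt (g := fun z => g z / R z) hgR (fun z hz => ?_)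
        (h.subset_closure_right ⟨h.mem, hxs⟩)
      rw [← hτ K' z (hBK hz), hc]
      simp only
      rw [hpos z (hB z hz)]
    have h1 : (((if e ∈ T then -1 else 1 : ℤˣ) : ℤ) : ℂ) * (g x / R x) = ((τ K : ℤ) : ℂ) := by
      refine eq_of_forall_mem_of_continuousAt
        (g := fun z => (((if e ∈ T then -1 else 1 : ℤˣ) : ℤ) : ℂ) * (g z / R z))
        (continuousAt_const.mul hgR) (fun z hz => ?_) (h.subset_closure_left ⟨h.mem, hxs⟩)
      rw [← hτ K z (hAK hz), hc]
      simp only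
      rw [hneg z (hA z hz), mul_div_assoc]
    rw [h2] at h1
    have h3 : (if e ∈ T then -1 else 1 : ℤˣ) * τ K' = τ K := Units.ext (by exact_mod_cast h1)
    rw [← h3, mul_assoc, Int.units_mul_self, mul_one]
  rcases hl.eq_and_eq_or_eq_and_eq hFF' with ⟨rfl, rfl⟩ | ⟨rfl, rfl⟩
  · exact key F F' hAL hBL
  · rw [mul_comm]
    exact key F' F hAL hBL

open scoped Classical in
/-- Every cut of the dual graph is even. -/
theorem even_degIn_of_coloring [Fintype V(G)] (T : Finset E(G)) (τ : V(P.dual) → ℤˣ)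
    (hτ : ∀ (e : E(G)) (F F' : V(P.dual)), P.dual.IsLink e F F' →
      τ F * τ F' = if e ∈ T then -1 else 1) (v : V(G)) : Even (degIn P.src P.tgt T v) := by
  have hface : ∀ z, z ∉ P.support → connectedComponentIn P.supportᶜ z ∈ V(P.dual) :=
    fun z hz => ⟨z, hz, rfl⟩
  -- The colour cancels the jumps of `prodRoot`. The value `0` on the drawing is never used: the
  -- limits below are taken within its complement.
  set f : ℂ → ℂ := fun z =>
    (if h : z ∉ P.support then ((τ ⟨_, hface z h⟩ : ℤ) : ℂ) else 0) * P.prodRoot T z with hf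
  have hfF : ∀ (F : V(P.dual)), ∀ z ∈ F.1, f z = ((τ F : ℤ) : ℂ) * P.prodRoot T z := by
    intro F z hz
    have hzs : z ∉ P.support := P.subset_compl_of_mem_faces F.2 hz
    have hFz : F = ⟨_, hface z hzs⟩ := Subtype.ext (P.eq_connectedComponentIn F.2 hz)
    rw [hf]
    simp only
    rw [dif_pos hzs, ← hFz]
  -- At an inner point of a segment both sides tend to the same value, so `extendFrom` continues `f`
  -- to the complement of the nodes.
  have hlim : ∀ x ∈ P.nodesᶜ, x ∈ closure P.supportᶜ ∧
      ∃ y, Filter.Tendsto f (𝓝[P.supportᶜ] x) (𝓝 y) := by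
    intro x hxn
    by_cases hxs : x ∈ P.support
    · obtain ⟨e, he, i, hi, hxi⟩ := P.exists_mem_openSegment hxs hxn
      obtain ⟨U, A, B, L, L', h, hA, hB, hl, hAL, hBL, -⟩ := P.exists_split_isLink hV hE he hi hxi
      obtain ⟨g, hg, hneg, hpos⟩ := P.exists_prodRoot_flip T ⟨e, he⟩ hi hxi
      have hAs : A ⊆ P.supportᶜ := fun z hz => (h.diff_eq ▸ Or.inl hz : z ∈ U \ P.support).2
      refine ⟨closure_mono hAs (h.subset_closure_left ⟨h.mem, hxs⟩), _,
        Filter.Tendsto.congr' (f₁ := fun z => ((τ ⟨L', hl.right_mem⟩ : ℤ) : ℂ) * g z) ?_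
        (continuousAt_const.mul hg).continuousWithinAt⟩
      filter_upwards [self_mem_nhdsWithin, mem_nhdsWithin_of_mem_nhds (h.isOpen.mem_nhds h.mem)]
        with z hzs hzU
      have hz : z ∈ A ∪ B := h.diff_eq ▸ ⟨hzU, hzs⟩
      rcases hz with hz | hz
      · rw [hfF ⟨L, hl.left_mem⟩ z (hAL hz), hneg z (hA z hz), ← mul_assoc]
        congr 1
        rw [← hτ ⟨e, he⟩ ⟨L, hl.left_mem⟩ ⟨L', hl.right_mem⟩ hl]
        norm_cast
        rw [← mul_assoc, Int.units_mul_self, one_mul]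
      · rw [hfF ⟨L', hl.right_mem⟩ z (hBL hz), hpos z (hB z hz)]
    · refine ⟨subset_closure hxs, _,
        Filter.Tendsto.congr' (f₁ := fun z => ((τ ⟨_, hface x hxs⟩ : ℤ) : ℂ) * P.prodRoot T z) ?_
        (continuousAt_const.mul (P.continuousAt_prodRoot_of_notMem hxs)).continuousWithinAt⟩
      filter_upwards [mem_nhdsWithin_of_mem_nhds ((P.isOpen_of_mem_faces hV hE (hface x hxs)).mem_nhds
        (mem_connectedComponentIn hxs))] with z hz
      exact (hfF ⟨_, hface x hxs⟩ z hz).symm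
  have hQc : Continuous fun z => ∏ u : V(G), (P.pt u - z) ^ degIn P.src P.tgt T u := by fun_prop
  have hfsq : ∀ z, z ∉ P.support → f z ^ 2 = ∏ u : V(G), (P.pt u - z) ^ degIn P.src P.tgt T u := by
    intro z hz
    rw [hfF ⟨_, hface z hz⟩ z (mem_connectedComponentIn hz), mul_pow, P.prodRoot_sq T hz]
    norm_cast
    rw [Int.units_sq, Units.val_one, Int.cast_one, one_mul]
  have hHc := continuousOn_extendFrom (f := f) (fun x hx => (hlim x hx).1) fun x hx => (hlim x hx).2
  have hHsq : ∀ x ∈ P.nodesᶜ, extendFrom P.supportᶜ f x ^ 2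
      = ∏ u : V(G), (P.pt u - x) ^ degIn P.src P.tgt T u := by
    intro x hx
    obtain ⟨hxc, y, hy⟩ := hlim x hx
    rw [extendFrom_eq hxc hy]
    have := mem_closure_iff_nhdsWithin_neBot.1 hxc
    refine tendsto_nhds_unique (hy.pow 2) (hQc.continuousAt.continuousWithinAt.tendsto.congr' ?_)
    filter_upwards [self_mem_nhdsWithin] with z hz
    exact (hfsq z hz).symm
  obtain ⟨ε, hε, hεN⟩ := Metric.mem_nhds_iff.1
    ((((P.finite_nodes hV hE).subset sdiff_subset :
      (P.nodes \ {P.pt v}).Finite).isClosed.isOpen_compl).mem_nhds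
      (show P.pt v ∉ P.nodes \ {P.pt v} from fun h => h.2 rfl))
  have hball : Metric.ball (P.pt v) ε \ {P.pt v} ⊆ P.nodesᶜ := fun z hz hzn =>
    hεN hz.1 ⟨hzn, hz.2⟩
  -- Split off the factor of `v`; the remaining product is nonzero at `pt v` because the vertices
  -- are distinct points.
  refine even_of_continuousOn_sq_eq hε (hHc.mono hball)
    (R := fun z => ∏ u ∈ Finset.univ.erase v, (P.pt u - z) ^ degIn P.src P.tgt T u) (by fun_prop)
    (Finset.prod_ne_zero_iff.2 fun u hu => pow_ne_zero _ (sub_ne_zero.2 fun h => ?_))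
    fun z hz => ?_
  · exact Finset.ne_of_mem_erase hu (Subtype.ext (P.pt_injOn u.2 v.2 h))
  · rw [hHsq z (hball hz)]
    exact (Finset.mul_prod_erase _ (fun u : V(G) => (P.pt u - z) ^ degIn P.src P.tgt T u)
      (Finset.mem_univ v)).symm

end PlaneEmbedding

/-! ### The mixed Ashkin–Teller model -/

/-- Every function of a sign `t` is affine in `t`; the coefficients are the half-sum and the
half-difference of its values. -/
theorem edgeWeight_eq_add (w : Fin 4 → ℝ) (s t : ℤˣ) :
    edgeWeight w s t = edgeWeight (hatWeights w) s 1 + edgeWeight (hatWeights w) s (-1) * (t : ℝ) := by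
  rcases Int.units_eq_one_or s with rfl | rfl <;> rcases Int.units_eq_one_or t with rfl | rfl <;>
    simp [edgeWeight, hatWeights] <;> ring

theorem edgeWeight_eq_ite (w : Fin 4 → ℝ) (s t : ℤˣ) :
    edgeWeight w s t = if t = 1 then edgeWeight w s 1 else edgeWeight w s (-1) := by
  rcases Int.units_eq_one_or t with rfl | rfl <;> simp

/-- The two half-differences are nonnegative because `K₂' + K₄ ≥ 0` and `K₂' - K₄ ≥ 0`. -/
theorem hatWeights_boltzmann_nonneg {K₂ K₂' K₄ : ℝ} (hK : |K₄| ≤ K₂') (k : Fin 4) :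
    0 ≤ hatWeights (boltzmann K₂ K₂' K₄) k := by
  obtain ⟨h1, h2⟩ := abs_le.1 hK
  have h01 : Real.exp (K₂ - K₂' - K₄) ≤ Real.exp (K₂ + K₂' + K₄) :=
    Real.exp_le_exp.2 (by linarith)
  have h23 : Real.exp (-K₂ - K₂' + K₄) ≤ Real.exp (-K₂ + K₂' - K₄) :=
    Real.exp_le_exp.2 (by linarith)
  fin_cases k <;> simp [hatWeights, boltzmann]
  · positivity
  · linarith
  · positivity
  · linarith

namespace PlaneEmbedding

variable {α β : Type*} {G : Graph α β} (P : PlaneEmbedding G)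

/-- The spins `σ` are spectators: for fixed `σ` they only enter the coefficients `a e` and `b e`,
and the duality is applied to the sum over `τ`. -/
theorem two_mul_ZAT (hV : V(G).Finite) (hE : E(G).Finite) (w : Fin 4 → ℝ) :
    2 * ZAT G w = 2 ^ V(G).ncard * ZMAT G P.dual (hatWeights w) := by
  classical
  have : Fintype V(G) := hV.fintype
  have : Fintype E(G) := hE.fintype
  have : Fintype V(P.dual) := (P.finite_faces hV hE).fintype
  have : Nonempty V(P.dual) := (P.nonempty_faces hV hE).to_subtype
  have hlink : ∀ e : E(G), ∃ F F' : V(P.dual), P.dual.IsLink e F F' := fun e => by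
    obtain ⟨F, F', h⟩ := (P.dual.edge_mem_iff_exists_isLink e).1
      ((P.dual_edgeSet hV hE).symm ▸ e.2 : e.1 ∈ E(P.dual))
    exact ⟨⟨F, h.left_mem⟩, ⟨F', h.right_mem⟩, h⟩
  choose dsrc dtgt hd using hlink
  have hcut : ∀ T : Finset E(G), (∀ v, Even (degIn P.src P.tgt T v)) ↔
      ∃ τ : V(P.dual) → ℤˣ, ∀ e, τ (dsrc e) * τ (dtgt e) = if e ∈ T then -1 else 1 := by
    refine fun T => ⟨fun hT => ?_, fun ⟨τ, hτ⟩ => P.even_degIn_of_coloring hV hE T τ ?_⟩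
    · obtain ⟨τ, hτ⟩ := P.exists_coloring hV hE T hT
      exact ⟨τ, fun e => hτ e _ _ (hd e)⟩
    · intro e F F' h
      rw [← hτ e]
      rcases h.eq_and_eq_or_eq_and_eq (hd e) with ⟨h1, h2⟩ | ⟨h1, h2⟩
      · rw [Subtype.ext h1, Subtype.ext h2]
      · rw [Subtype.ext h1, Subtype.ext h2, mul_comm]
  have hconn : ∀ τ : V(P.dual) → ℤˣ, (∀ e, τ (dsrc e) * τ (dtgt e) = 1) →
      ∀ f f', τ f = τ f' := by
    intro τ hτ f f'
    have hlink : ∀ e (F F' : V(P.dual)), P.dual.IsLink e F F' → τ F = τ F' := by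
      intro e F F' h
      obtain ⟨e', rfl⟩ : ∃ e' : E(G), e'.1 = e := ⟨⟨e, h.1⟩, rfl⟩
      have h1 := hτ e'
      rw [← Int.units_inv_eq_self (τ (dtgt _)), mul_inv_eq_one] at h1
      rcases h.eq_and_eq_or_eq_and_eq (hd e') with ⟨h2, h3⟩ | ⟨h2, h3⟩
      · rw [Subtype.ext h2, Subtype.ext h3, h1]
      · rw [Subtype.ext h2, Subtype.ext h3, h1]
    -- Having the same spin as `f` is preserved along dual edges, hence holds for all faces.
    obtain ⟨_, h⟩ := P.dual_induction hV hE (Q := fun H => ∃ h : H ∈ V(P.dual), τ ⟨H, h⟩ = τ f)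
      (fun e F F' h => ⟨fun ⟨_, hF⟩ => ⟨h.right_mem, (hlink e ⟨F, _⟩ ⟨F', _⟩ h).symm.trans hF⟩,
        fun ⟨_, hF⟩ => ⟨h.left_mem, (hlink e ⟨F, _⟩ ⟨F', _⟩ h).trans hF⟩⟩) f.2 f'.2 ⟨f.2, rfl⟩
    exact h.symm
  rw [ZAT, ZMAT, ← Nat.card_coe_set_eq, Nat.card_eq_fintype_card]
  simp only [finsum_eq_sum_of_fintype, ← finprod_set_coe_eq_finprod_mem,
    finprod_eq_prod_of_fintype, bond_eq G _ (P.isLink_src_tgt _), bond_eq P.dual _ (hd _)]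
  rw [Finset.mul_sum, Finset.mul_sum]
  refine Finset.sum_congr rfl fun σ _ => ?_
  have h := two_mul_sum_prod_eq P.src P.tgt dsrc dtgt hcut hconn
    (fun e => edgeWeight (hatWeights w) (σ (P.src e) * σ (P.tgt e)) 1)
    (fun e => edgeWeight (hatWeights w) (σ (P.src e) * σ (P.tgt e)) (-1))
  simp only [← edgeWeight_eq_add, ← edgeWeight_eq_ite] at h
  exact h

end PlaneEmbedding

end AshkinTeller

end

theorem theorem4p1 {α β : Type*} (G : Graph α β) (hV : G.vertexSet.Finite)
    (hE : G.edgeSet.Finite) (P : AshkinTeller.PlaneEmbedding G)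
    (K₂ K₂' K₄ : ℝ) (hK : |K₄| ≤ K₂') (w : Fin 4 → ℝ)
    (hw : w = AshkinTeller.boltzmann K₂ K₂' K₄) :
    P.dual.vertexSet.Finite ∧ P.dual.edgeSet = G.edgeSet ∧
    (∀ k, 0 ≤ AshkinTeller.hatWeights w k) ∧
    AshkinTeller.ZAT G w =
      (2 : ℝ) ^ ((G.vertexSet.ncard : ℤ) - 1) *
        AshkinTeller.ZMAT G P.dual (AshkinTeller.hatWeights w) := by
  subst hw
  refine ⟨P.finite_faces hV hE, P.dual_edgeSet hV hE,
    AshkinTeller.hatWeights_boltzmann_nonneg hK, ?_⟩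
  have h := P.two_mul_ZAT hV hE (AshkinTeller.boltzmann K₂ K₂' K₄)
  -- The exponent is an integer, so the empty graph, with exponent `-1`, is covered.
  rw [zpow_sub₀ two_ne_zero, zpow_natCast, zpow_one]
  linear_combination h / 2
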